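/- A tournament is a finite digraph without loops in which, for every two distinct vertices $u,v$, exactly one of $uv$ and $vu$ is an arc; it is regular if the outdegree of every vertex equals its indegree. For a set $S$ of vertices, $T-S$ denotes the subtournament of $T$ induced by the vertices outside $S$. An $(x,y)$-path of length $r$ is a sequence of $r+1$ distinct vertices $x=x_0,x_1,\dots,x_r=y$ such that $x_ix_{i+1}$ is an arc for every $0\le i<r$. Theorem. Let $T$ be a regular tournament of order $2n+1\ge 11$ and let $S\subseteq V(T)$ satisfy $|S|\le\frac12(n-2)$. Let $x$ and $y$ be two distinct vertices in $V(T)\setminus S$, and let $r$ be an integer with $3\le r\le 2n-|S|-1$. If $T-S$ contains an $(x,y)$-path of length $r$, then $T-S$ also contains an $(x,y)$-path of length $r+1$. -/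

import Mathlib

namespace Digraph

variable {V : Type*}

/-- A digraph is a tournament if it has no loops, no two opposite arcs, and every two distinct
vertices are adjacent: for distinct `u`, `v`, exactly one of `uv` and `vu` is an arc. -/
structure IsTournament (D : Digraph V) : Prop where
  loopless : ∀ v, ¬ D.Adj v v
  asymm : ∀ u v, D.Adj u v → ¬ D.Adj v u
  adjacent : ∀ u v, u ≠ v → D.Adj u v ∨ D.Adj v u

/-- The outdegree of `v`: the number of vertices `w` such that `vw` is an arc. -/
noncomputable def outDegree (D : Digraph V) (v : V) : ℕ := {w | D.Adj v w}.ncard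

/-- The indegree of `v`: the number of vertices `w` such that `wv` is an arc. -/
noncomputable def inDegree (D : Digraph V) (v : V) : ℕ := {w | D.Adj w v}.ncard

/-- A regular tournament: every vertex has the same outdegree as indegree
(that is, the irregularity `max |d⁺(v) - d⁻(v)|` is zero). -/
structure IsRegularTournament (D : Digraph V) : Prop extends D.IsTournament where
  outDegree_eq_inDegree : ∀ v, D.outDegree v = D.inDegree v

/-- `D - S`: the subdigraph of `D` induced by the vertices outside `S`. -/
def deleteVerts (D : Digraph V) (S : Set V) : Digraph {v : V // v ∉ S} where
  Adj u v := D.Adj u v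

/-- `D` contains a (simple, directed) path from `x` to `y` of length `r`: a sequence of `r + 1`
distinct vertices `p 0 = x, p 1, …, p r = y`, each dominating the next. -/
def HasPathOfLength (D : Digraph V) (x y : V) (r : ℕ) : Prop :=
  ∃ p : Fin (r + 1) → V, Function.Injective p ∧ p 0 = x ∧ p (Fin.last r) = y ∧
    ∀ i : Fin r, D.Adj (p i.castSucc) (p i.succ)

end Digraph

/-! Deleting `S` leaves a tournament on `n + a + 1` vertices, `a = n - |S|`, whose in- and
outdegrees lie between `a` and `n`, where `n + 2 ≤ 2 * a`. Label the given path `0 → 1 → ⋯ → r` and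
suppose that no path from `0` to `r` has one more vertex. A vertex `w` off the path cannot be
inserted between `i` and `i + 1`, so it dominates an initial segment `[0, k w - 1]` of the path and
is dominated by the rest. `Config` records this situation, `Config.elim` refutes it, and
`Config.reverse` makes every statement available in a mirrored form.

Chords of the path and arcs off the path give reroutings, hence many forbidden arcs. Together with
degree counts they exclude the thresholds `0`, `1`, `2` (`not_zero`, `two_le`, `three_le_k`) and, by
reversal, `r + 1`, `r`, `r - 1`.

Let `w₀` and `w₁` have the least and the greatest threshold. Suppose that some vertex of the low
segment `[1, k w₀ - 1]` dominates `r`, and that `0` dominates some vertex of the high segment `[k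
w₁, r - 1]`. The low segment is strongly connected unless it is tiny (`exists_adj_back`), so it has
a Hamiltonian path ending at an in-neighbour of `r`; dually the high segment has one starting at an
out-neighbour of `0`. Then `0`, high, middle, low, `r` is a path with `r + 2` vertices. So one of
the two assumptions fails (`not_adj_last_or_not_adj_zero`).

But `exists_adj_last`, applied to the configuration and to its reversal, shows that both hold: if
the low segment sends no arc to `r`, the in-neighbours of `r` lie high on the path and block the
columns just above them, and the low vertices are left with too few out-arcs. -/

namespace PathExtension

open Finset
open scoped Classical

/-! ### Paths as concatenations -/

/-- `HamPath R s u v l`: the finset `s` has `l` elements and carries a directed path of the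
relation `R` from `u` to `v` that visits each element of `s` exactly once. -/
inductive HamPath (R : ℕ → ℕ → Prop) : Finset ℕ → ℕ → ℕ → ℕ → Prop
  | single (u : ℕ) : HamPath R {u} u u 1
  | cat {s t : Finset ℕ} {u v u' v' l l' : ℕ} : HamPath R s u v l → HamPath R t u' v' l' →
      Disjoint s t → R v u' → HamPath R (s ∪ t) u v' (l + l')

namespace HamPath

variable {R : ℕ → ℕ → Prop} {s t : Finset ℕ} {u v u' v' l l' : ℕ}

theorem card_eq (h : HamPath R s u v l) : s.card = l := by
  induction h with
  | single u => simp
  | cat _ _ hd _ ih1 ih2 => rw [card_union_of_disjoint hd, ih1, ih2]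

theorem left_mem (h : HamPath R s u v l) : u ∈ s := by
  induction h with
  | single u => simp
  | cat _ _ _ _ ih1 ih2 => exact mem_union_left _ ih1

theorem right_mem (h : HamPath R s u v l) : v ∈ s := by
  induction h with
  | single u => simp
  | cat _ _ _ _ ih1 ih2 => exact mem_union_right _ ih2

theorem congr (h : HamPath R s u v l) (hs : s = t) (hl : l = l') : HamPath R t u v l' := by
  subst hs; subst hl; exact h

theorem reverse_image {σ : ℕ → ℕ} (hσ : Function.Injective σ)
    (h : HamPath (fun x y => R (σ y) (σ x)) s u v l) :
    HamPath R (s.image σ) (σ v) (σ u) l := by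
  induction h with
  | single u => simpa using single (σ u)
  | cat _ _ hd hr ih1 ih2 =>
    rw [image_union, union_comm, Nat.add_comm]
    refine cat ih2 ih1 ?_ hr
    rw [disjoint_image hσ]
    exact hd.symm

theorem Icc_self_le {R : ℕ → ℕ → Prop} {i j : ℕ} (hij : i ≤ j)
    (h : ∀ k, i ≤ k → k < j → R k (k + 1)) : HamPath R (Icc i j) i j (j + 1 - i) := by
  induction j, hij using Nat.le_induction with
  | base => simpa using single i
  | succ j hj ih =>
    refine (cat (ih fun k hk hkj => h k hk (by omega)) (single (j + 1)) ?_
      (h j hj (by omega))).congr ?_ (by omega)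
    · simp
    · ext x; simp; omega

theorem exists_list (h : HamPath R s u v l) : ∃ L : List ℕ, L.length = l ∧ L.Nodup ∧
    L.IsChain R ∧ (∀ x, x ∈ L ↔ x ∈ s) ∧ L.head? = some u ∧ L.getLast? = some v := by
  induction h with
  | single u => exact ⟨[u], by simp⟩
  | cat _ _ hd hr ih1 ih2 =>
    obtain ⟨L, h1, h2, h3, h4, h5, h6⟩ := ih1
    obtain ⟨L', h1', h2', h3', h4', h5', h6'⟩ := ih2
    refine ⟨L ++ L', by simp [h1, h1'], ?_, ?_, ?_, ?_, ?_⟩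
    · rw [List.nodup_append']
      refine ⟨h2, h2', fun x hx hx' => ?_⟩
      exact (disjoint_left.1 hd) ((h4 x).1 hx) ((h4' x).1 hx')
    · rw [List.isChain_append]
      refine ⟨h3, h3', fun x hx y hy => ?_⟩
      rw [h6] at hx; rw [h5'] at hy
      simp at hx hy
      subst hx; subst hy; exact hr
    · intro x; simp [h4, h4']
    · simp [List.head?_append, h5]
    · simp [List.getLast?_append, h6']

end HamPath

/-! ### Counting arcs -/

/-- The number of arcs of `R` from `s` to `t`. -/
noncomputable def arcs (R : ℕ → ℕ → Prop) (s t : Finset ℕ) : ℕ :=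
  ∑ u ∈ s, (t.filter (R u)).card

section arcs

variable {R : ℕ → ℕ → Prop} {s s' t t' : Finset ℕ}

theorem arcs_union_left (h : Disjoint s s') : arcs R (s ∪ s') t = arcs R s t + arcs R s' t :=
  sum_union h

theorem arcs_union_right (h : Disjoint t t') : arcs R s (t ∪ t') = arcs R s t + arcs R s t' := by
  unfold arcs
  rw [← sum_add_distrib]
  refine sum_congr rfl fun u _ => ?_
  rw [filter_union, card_union_of_disjoint (disjoint_filter_filter h)]

theorem arcs_comm : arcs R s t = ∑ v ∈ t, (s.filter (R · v)).card := by
  unfold arcs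
  simp only [card_filter]
  exact sum_comm

theorem arcs_le_mul : arcs R s t ≤ s.card * t.card := by
  unfold arcs
  calc _ ≤ ∑ u ∈ s, t.card := sum_le_sum fun u _ => card_filter_le _ _
    _ = _ := by simp

theorem arcs_mono (hs : s ⊆ s') (ht : t ⊆ t') : arcs R s t ≤ arcs R s' t' := by
  unfold arcs
  calc _ ≤ ∑ u ∈ s, (t'.filter (R u)).card :=
        sum_le_sum fun u _ => card_le_card (filter_subset_filter _ ht)
    _ ≤ _ := sum_le_sum_of_subset hs

theorem arcs_eq_zero (h : ∀ u ∈ s, ∀ v ∈ t, ¬ R u v) : arcs R s t = 0 := by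
  unfold arcs
  refine sum_eq_zero fun u hu => ?_
  rw [card_eq_zero, filter_eq_empty_iff]
  exact fun v hv => h u hu v hv

theorem arcs_eq_mul (h : ∀ u ∈ s, ∀ v ∈ t, R u v) : arcs R s t = s.card * t.card := by
  unfold arcs
  rw [sum_congr rfl (g := fun _ => t.card), sum_const, smul_eq_mul]
  intro u hu
  rw [filter_true_of_mem (h u hu)]

theorem arcs_pos {u v : ℕ} (hu : u ∈ s) (hv : v ∈ t) (h : R u v) : 1 ≤ arcs R s t := by
  unfold arcs
  have : 1 ≤ (t.filter (R u)).card := card_pos.2 ⟨v, by simp [hv, h]⟩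
  exact this.trans (single_le_sum (f := fun u => (t.filter (R u)).card) (fun _ _ => Nat.zero_le _) hu)

theorem arcs_singleton_left {u : ℕ} : arcs R {u} t = (t.filter (R u)).card := by simp [arcs]

theorem arcs_singleton_right {v : ℕ} : arcs R s {v} = (s.filter (R · v)).card := by
  rw [arcs_comm]; simp

theorem arcs_add_swap (h1 : ∀ u ∈ s, ∀ v ∈ t, R u v → ¬ R v u)
    (h2 : ∀ u ∈ s, ∀ v ∈ t, R u v ∨ R v u) : arcs R s t + arcs R t s = s.card * t.card := by
  rw [arcs_comm (s := t)]
  unfold arcs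
  rw [← sum_add_distrib, sum_congr rfl (g := fun _ => t.card)]
  · simp
  · intro u hu
    rw [← card_filter_add_card_filter_not (s := t) (R u)]
    congr 2
    ext v
    simp only [mem_filter, and_congr_right_iff]
    exact fun hv => ⟨fun h h' => h1 u hu v hv h' h, fun h => (h2 u hu v hv).resolve_left h⟩

theorem two_mul_arcs_self (h1 : ∀ u ∈ s, ∀ v ∈ s, R u v → ¬ R v u)
    (h2 : ∀ u ∈ s, ∀ v ∈ s, u ≠ v → R u v ∨ R v u) :
    2 * arcs R s s + s.card = s.card * s.card := by
  induction s using Finset.induction_on with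
  | empty => simp [arcs]
  | insert x s hx ih =>
    have ih' := ih (fun u hu v hv => h1 u (mem_insert_of_mem hu) v (mem_insert_of_mem hv))
      (fun u hu v hv => h2 u (mem_insert_of_mem hu) v (mem_insert_of_mem hv))
    have hd : Disjoint {x} s := by simpa using hx
    rw [insert_eq, arcs_union_left hd, arcs_union_right hd, arcs_union_right hd,
      card_union_of_disjoint hd, card_singleton]
    have hsw : arcs R {x} s + arcs R s {x} = 1 * s.card := by
      rw [← card_singleton x]
      refine arcs_add_swap (fun u hu v hv => h1 u ?_ v ?_) (fun u hu v hv => h2 u ?_ v ?_ ?_)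
      all_goals simp_all
      rintro rfl; exact hx hv
    have h0 : arcs R {x} {x} = 0 := arcs_eq_zero fun u hu v hv h => by
      simp at hu hv; subst hu; subst hv
      exact h1 _ (mem_insert_self _ _) _ (mem_insert_self _ _) h h
    rw [h0]
    nlinarith

end arcs

/-! ### Hamiltonian paths with a prescribed last vertex -/

/-- The cut condition says that `u` is reachable from every vertex of `s`. Remove `u`: a minimal
nonempty set `Z₀` closed under out-arcs is the terminal strong component of the rest, and by the cut
condition some `c ∈ Z₀` dominates `u`. Every vertex of the rest reaches `c`, so induction gives a
Hamiltonian path ending at `c`, which `u` prolongs. -/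
theorem HamPath.exists_ending_at {R : ℕ → ℕ → Prop} (n : ℕ) : ∀ (s : Finset ℕ) (u : ℕ),
    s.card = n → u ∈ s → (∀ x ∈ s, ∀ y ∈ s, x ≠ y → R x y ∨ R y x) →
    (∀ Z ⊆ s, Z.Nonempty → u ∉ Z → ∃ z ∈ Z, ∃ v ∈ s, v ∉ Z ∧ R z v) →
    ∃ v, HamPath R s v u s.card := by
  induction n with
  | zero => intro s u hs hu; simp at hs; simp [hs] at hu
  | succ n ih =>
    intro s u hs hu htot hreach
    by_cases hne : (s.erase u).Nonempty
    swap
    · have : s = {u} := by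
        rw [not_nonempty_iff_eq_empty] at hne
        rw [← insert_erase hu, hne]
        simp
      exact ⟨u, by rw [this]; simpa using HamPath.single u⟩
    let closed : Finset (Finset ℕ) := (s.erase u).powerset.filter fun Z =>
      Z.Nonempty ∧ ∀ z ∈ Z, ∀ v ∈ s.erase u, v ∉ Z → ¬ R z v
    have hcl : closed.Nonempty := ⟨s.erase u, by
      simp only [closed, mem_filter, mem_powerset]
      exact ⟨Subset.rfl, hne, fun z _ v hv hv' => absurd hv hv'⟩⟩
    obtain ⟨Z₀, hZ₀, hmin⟩ := exists_min_image closed card hcl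
    simp only [closed, mem_filter, mem_powerset] at hZ₀ hmin
    obtain ⟨hsub, hZne, hZcl⟩ := hZ₀
    obtain ⟨c, hc, v, hv, hvZ, hcv⟩ := hreach Z₀ (hsub.trans (erase_subset _ _)) hZne
      (fun h => by simpa using hsub h)
    have hvu : v = u := by
      by_contra hne'
      exact hZcl c hc v (mem_erase.2 ⟨hne', hv⟩) hvZ hcv
    subst hvu
    obtain ⟨x, hx⟩ := ih (s.erase v) c (by rw [card_erase_of_mem hu, hs]; rfl) (hsub hc)
      (fun x hx y hy => htot x (mem_of_mem_erase hx) y (mem_of_mem_erase hy)) (by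
        intro Z hZ hZn hcZ
        by_contra hcon
        push Not at hcon
        have hZ' : ∀ z ∈ Z, ∀ w ∈ s.erase v, w ∉ Z → ¬ R z w :=
          fun z hz w hw hwZ => hcon z hz w hw hwZ
        by_cases hint : (Z ∩ Z₀).Nonempty
        · have := hmin (Z ∩ Z₀) ⟨inter_subset_left.trans hZ, hint, by
            intro z hz w hw hwZ
            rw [mem_inter] at hz
            by_cases hwZ' : w ∈ Z
            · exact hZcl z hz.2 w hw fun h => hwZ (mem_inter.2 ⟨hwZ', h⟩)
            · exact hZ' z hz.1 w hw hwZ'⟩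
          have heq : Z ∩ Z₀ = Z₀ := eq_of_subset_of_card_le inter_subset_right this
          exact hcZ (inter_subset_left (heq ▸ hc))
        · obtain ⟨z, hz⟩ := hZn
          have hzZ₀ : z ∉ Z₀ := fun h => hint ⟨z, mem_inter.2 ⟨hz, h⟩⟩
          rcases htot z (mem_of_mem_erase (hZ hz)) c (mem_of_mem_erase (hsub hc))
            (fun h => hcZ (h ▸ hz)) with h | h
          · exact hZ' z hz c (hsub hc) hcZ h
          · exact hZcl c hc z (hZ hz) hzZ₀ h)
    refine ⟨x, (HamPath.cat hx (HamPath.single v) (by simp) hcv).congr ?_ ?_⟩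
    · rw [union_comm, ← insert_eq, insert_erase hu]
    · rw [card_erase_of_mem hu]
      have : 0 < s.card := card_pos.2 ⟨v, hu⟩
      omega

/-- A Hamiltonian path of an interval of a path `i → i + 1 → ⋯ → j` can be made to end at `t`. -/
theorem HamPath.exists_Icc_ending_at {R : ℕ → ℕ → Prop} {i j t : ℕ} (hi : i ≤ t) (hj : t ≤ j)
    (hstep : ∀ x, i ≤ x → x < j → R x (x + 1))
    (htot : ∀ x ∈ Icc i j, ∀ y ∈ Icc i j, x ≠ y → R x y ∨ R y x)
    (h : ∀ z, t < z → z ≤ j → ∃ u v, z ≤ u ∧ u ≤ j ∧ i ≤ v ∧ v < z ∧ R u v) :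
    ∃ u, i ≤ u ∧ u ≤ j ∧ HamPath R (Icc i j) u t (j + 1 - i) := by
  obtain ⟨u, hu⟩ := HamPath.exists_ending_at _ (Icc i j) t rfl (by simp; omega) htot (by
    intro Z hZ hne htZ
    by_contra hcon
    push Not at hcon
    -- The steps `x → x + 1` make a closed set a final segment, so only cuts of the interval need
    -- testing.
    have hup : ∀ d x, x ∈ Z → x + d ≤ j → x + d ∈ Z := by
      intro d
      induction d with
      | zero => intro x hx _; exact hx
      | succ d ih =>
        intro x hx hxd
        have h1 := ih x hx (by omega)
        by_contra hc
        have h2 := hZ hx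
        rw [mem_Icc] at h2
        exact hcon _ h1 (x + (d + 1)) (by simp; omega) hc (hstep _ (by omega) (by omega))
    have hmem := Z.min'_mem hne
    set z := Z.min' hne with hz
    have hzI := mem_Icc.1 (hZ hmem)
    have htz : t < z := by
      by_contra hle
      have := hup (t - z) z hmem (by omega)
      rw [show z + (t - z) = t by omega] at this
      exact htZ this
    obtain ⟨u, v, h1, h2, h3, h4, h5⟩ := h z htz hzI.2
    have huZ := hup (u - z) z hmem (by omega)
    rw [show z + (u - z) = u by omega] at huZ
    refine hcon u huZ v (by simp; omega) (fun hv => ?_) h5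
    have := Z.min'_le v hv
    omega)
  have := mem_Icc.1 hu.left_mem
  exact ⟨u, this.1, this.2, hu.congr rfl (by simp)⟩

/-! ### The extremal configuration and its reversal -/

/-- A tournament `R` on `{0, …, n + a}` with all in- and outdegrees at least `a`, in which
`0 → 1 → ⋯ → r` is a path, but no path from `0` to `r` has `r + 2` vertices. A vertex `w` off the
path dominates `i ≤ r` if and only if `i < k w`. -/
structure Config (R : ℕ → ℕ → Prop) (n a r : ℕ) (k : ℕ → ℕ) : Prop where
  four_le : 4 ≤ a
  a_le : a ≤ n
  le_two_mul : n + 2 ≤ 2 * a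
  three_le : 3 ≤ r
  r_lt : r < n + a
  lt_of_adj : ∀ u v, R u v → u ≤ n + a ∧ v ≤ n + a
  asymm : ∀ u v, R u v → ¬ R v u
  total : ∀ u v, u ≤ n + a → v ≤ n + a → u ≠ v → R u v ∨ R v u
  step : ∀ i, i < r → R i (i + 1)
  le_out : ∀ u, u ≤ n + a → a ≤ ((range (n + a + 1)).filter (R u)).card
  le_in : ∀ u, u ≤ n + a → a ≤ ((range (n + a + 1)).filter (R · u)).card
  no_path : ∀ s, ¬ HamPath R s 0 r (r + 2)
  k_le : ∀ w, k w ≤ r + 1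
  adj_of_lt : ∀ w, r < w → w ≤ n + a → ∀ i, i ≤ r → i < k w → R w i
  adj_of_le : ∀ w, r < w → w ≤ n + a → ∀ i, i ≤ r → k w ≤ i → R i w

/-- The involution of the vertex set that reverses the path `0, …, r`. -/
def flip (r i : ℕ) : ℕ := if i ≤ r then r - i else i

theorem flip_of_le {r i : ℕ} (h : i ≤ r) : flip r i = r - i := if_pos h

theorem flip_of_gt {r i : ℕ} (h : r < i) : flip r i = i := if_neg (by omega)

theorem flip_flip (r i : ℕ) : flip r (flip r i) = i := by
  unfold flip; split_ifs <;> omega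

theorem flip_injective (r : ℕ) : Function.Injective (flip r) := fun x y h => by
  rw [← flip_flip r x, h, flip_flip]

theorem flip_le {r i N : ℕ} (hr : r ≤ N) : flip r i ≤ N ↔ i ≤ N := by
  unfold flip; split_ifs <;> omega

theorem card_filter_flip {r N : ℕ} (hr : r ≤ N) (p : ℕ → Prop) :
    ((range (N + 1)).filter fun x => p (flip r x)).card = ((range (N + 1)).filter p).card := by
  rw [← card_image_of_injective _ (flip_injective r)]
  congr 1
  ext x
  simp only [mem_image, mem_filter, mem_range, Nat.lt_succ_iff]
  constructor
  · rintro ⟨y, ⟨hy, hp⟩, rfl⟩; exact ⟨(flip_le hr).2 hy, hp⟩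
  · rintro ⟨hx, hp⟩
    exact ⟨flip r x, ⟨(flip_le hr).2 hx, by rwa [flip_flip]⟩, flip_flip r x⟩

namespace Config

variable {R : ℕ → ℕ → Prop} {n a r : ℕ} {k : ℕ → ℕ}

theorem reverse (c : Config R n a r k) :
    Config (fun u v => R (flip r v) (flip r u)) n a r (fun w => r + 1 - k w) where
  four_le := c.four_le
  a_le := c.a_le
  le_two_mul := c.le_two_mul
  three_le := c.three_le
  r_lt := c.r_lt
  lt_of_adj u v h := by
    have := c.lt_of_adj _ _ h
    rw [flip_le c.r_lt.le, flip_le c.r_lt.le] at this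
    exact this.symm
  asymm u v h := c.asymm _ _ h
  total u v hu hv huv := by
    rcases c.total (flip r u) (flip r v) ((flip_le c.r_lt.le).2 hu) ((flip_le c.r_lt.le).2 hv)
      (fun h => huv (flip_injective r h)) with h | h
    · exact Or.inr h
    · exact Or.inl h
  step i hi := by
    rw [flip_of_le (by omega), flip_of_le (by omega)]
    have := c.step (r - (i + 1)) (by omega)
    rwa [show r - (i + 1) + 1 = r - i by omega] at this
  le_out u hu := by
    rw [card_filter_flip c.r_lt.le fun v => R v (flip r u)]
    exact c.le_in _ ((flip_le c.r_lt.le).2 hu)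
  le_in u hu := by
    rw [card_filter_flip c.r_lt.le fun v => R (flip r u) v]
    exact c.le_out _ ((flip_le c.r_lt.le).2 hu)
  no_path s h := by
    have := h.reverse_image (flip_injective r)
    rw [flip_of_le le_rfl, flip_of_le (Nat.zero_le _), Nat.sub_self, Nat.sub_zero] at this
    exact c.no_path _ this
  k_le w := by omega
  adj_of_lt w hw hw' i hi hik := by
    rw [flip_of_gt hw, flip_of_le hi]
    exact c.adj_of_le w hw hw' _ (by omega) (by omega)
  adj_of_le w hw hw' i hi hik := by
    rw [flip_of_gt hw, flip_of_le hi]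
    have := c.k_le w
    exact c.adj_of_lt w hw hw' _ (by omega) (by omega)

theorem not_adj_self (c : Config R n a r k) (u : ℕ) : ¬ R u u := fun h => c.asymm u u h h

theorem adj_of_not (c : Config R n a r k) {u v : ℕ} (hu : u ≤ n + a) (hv : v ≤ n + a)
    (huv : u ≠ v) (h : ¬ R u v) : R v u := (c.total u v hu hv huv).resolve_left h

/-! ### Forbidden reroutings -/

theorem Icc_path (c : Config R n a r k) {i j : ℕ} (hij : i ≤ j) (hj : j ≤ r) :
    HamPath R (Icc i j) i j (j + 1 - i) :=
  HamPath.Icc_self_le hij fun x _ hx => c.step x (by omega)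

theorem lt_of_adj_right (c : Config R n a r k) {w i : ℕ} (hw : r < w) (hw' : w ≤ n + a)
    (hi : i ≤ r) (h : R w i) : i < k w := by
  by_contra hc
  exact c.asymm _ _ h (c.adj_of_le w hw hw' i hi (by omega))

theorem le_of_adj_left (c : Config R n a r k) {w i : ℕ} (hw : r < w) (hw' : w ≤ n + a)
    (hi : i ≤ r) (h : R i w) : k w ≤ i := by
  by_contra hc
  exact c.asymm _ _ h (c.adj_of_lt w hw hw' i hi (by omega))

/-- Otherwise `0 ⋯ i, j ⋯ q - 1, w, s ⋯ u, q ⋯ r` is a path through all the old vertices and `w`. -/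
theorem not_adj_of_detour (c : Config R n a r k) {w i j q s u : ℕ} (hw : r < w) (hw' : w ≤ n + a)
    (hij : i < j) (hjq : j < q) (hkq : k w < q) (hq : q ≤ r) (hadj : R i j)
    (hp : HamPath R (Icc (i + 1) (j - 1)) s u (j - 1 - i)) (hs : s < k w) : ¬ R u q := by
  intro hu
  have hsm := mem_Icc.1 hp.left_mem
  have p1 := (c.Icc_path (Nat.zero_le i) (by omega)).cat (c.Icc_path (i := j) (j := q - 1)
    (by omega) (by omega)) (by simp only [disjoint_left, mem_Icc]; omega) hadj
  have p2 := p1.cat (HamPath.single w) (by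
    simp only [disjoint_left, mem_union, mem_Icc, mem_singleton]; omega)
    (c.adj_of_le w hw hw' _ (by omega) (by omega))
  have p3 := p2.cat hp (by
    simp only [disjoint_left, mem_union, mem_Icc, mem_singleton]; omega)
    (c.adj_of_lt w hw hw' _ (by omega) hs)
  have p4 := p3.cat (c.Icc_path (i := q) (j := r) (by omega) le_rfl) (by
    simp only [disjoint_left, mem_union, mem_Icc, mem_singleton]; omega) hu
  exact c.no_path _ (p4.congr rfl (by omega))

theorem not_adj_pred (c : Config R n a r k) {w i j q : ℕ} (hw : r < w) (hw' : w ≤ n + a)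
    (hij : i + 2 ≤ j) (hik : i + 2 ≤ k w) (hjq : j < q) (hkq : k w < q) (hq : q ≤ r)
    (hadj : R i j) : ¬ R (j - 1) q :=
  c.not_adj_of_detour hw hw' (by omega) hjq hkq hq hadj
    ((c.Icc_path (by omega) (by omega)).congr rfl (by omega)) (by omega)

/-- If `j - 1 → i + 1`, then `0 ⋯ i, j ⋯ q - 1, w, p + 1 ⋯ j - 1, i + 1 ⋯ p, q ⋯ r` is too long.
Iterated, this slides a chord inwards. -/
theorem adj_succ_pred (c : Config R n a r k) {w i j p q : ℕ} (hw : r < w) (hw' : w ≤ n + a)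
    (hip : i < p) (hpk : p + 2 ≤ k w) (hpj : p + 2 ≤ j) (hjq : j < q) (hkq : k w < q) (hq : q ≤ r)
    (h1 : R i j) (h2 : R p q) : R (i + 1) (j - 1) := by
  have hr := c.r_lt
  refine c.adj_of_not (by omega) (by omega) (by omega) fun h3 => ?_
  have p1 := (c.Icc_path (Nat.zero_le i) (by omega)).cat (c.Icc_path (i := j) (j := q - 1)
    (by omega) (by omega)) (by simp only [disjoint_left, mem_Icc]; omega) h1
  have p2 := p1.cat (HamPath.single w) (by
    simp only [disjoint_left, mem_union, mem_Icc, mem_singleton]; omega)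
    (c.adj_of_le w hw hw' _ (by omega) (by omega))
  have p3 := p2.cat (c.Icc_path (i := p + 1) (j := j - 1) (by omega) (by omega)) (by
    simp only [disjoint_left, mem_union, mem_Icc, mem_singleton]; omega)
    (c.adj_of_lt w hw hw' _ (by omega) (by omega))
  have p4 := p3.cat (c.Icc_path (i := i + 1) (j := p) (by omega) (by omega)) (by
    simp only [disjoint_left, mem_union, mem_Icc, mem_singleton]; omega) h3
  have p5 := p4.cat (c.Icc_path (i := q) (j := r) (by omega) le_rfl) (by
    simp only [disjoint_left, mem_union, mem_Icc, mem_singleton]; omega) h2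
  exact c.no_path _ (p5.congr rfl (by omega))

/-- Otherwise the `t` off-path vertices could replace the `t - 1` path vertices strictly between `k
u` and `k u + t`. -/
theorem le_of_path (c : Config R n a r k) {s : Finset ℕ} {u v t : ℕ} (h : HamPath R s u v t)
    (hs : ∀ w ∈ s, r < w ∧ w ≤ n + a) : k v ≤ k u + t := by
  by_contra hc
  have hv := c.k_le v
  obtain ⟨hu1, hu2⟩ := hs u h.left_mem
  obtain ⟨hv1, hv2⟩ := hs v h.right_mem
  have p1 := (c.Icc_path (Nat.zero_le (k u)) (by omega)).cat h (by
    simp only [disjoint_left, mem_Icc]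
    intro x hx hxs
    have := (hs x hxs).1
    omega) (c.adj_of_le u hu1 hu2 _ (by omega) le_rfl)
  have p2 := p1.cat (c.Icc_path (i := k u + t) (j := r) (by omega) le_rfl) (by
    simp only [disjoint_left, mem_union, mem_Icc]
    rintro x (hx | hx)
    · have : 0 < t := by rw [← h.card_eq]; exact card_pos.2 ⟨u, h.left_mem⟩
      omega
    · have := (hs x hx).1
      omega) (c.adj_of_lt v hv1 hv2 _ (by omega) (by omega))
  exact c.no_path _ (p2.congr rfl (by omega))

theorem le_add_two (c : Config R n a r k) {u v : ℕ} (hu : r < u) (hv : r < v) (h : R u v) :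
    k v ≤ k u + 2 := by
  have hl := c.lt_of_adj _ _ h
  have hne : u ≠ v := by rintro rfl; exact c.not_adj_self _ h
  refine c.le_of_path ((HamPath.single u).cat (HamPath.single v) (by simpa using hne) h) ?_
  intro w hw
  simp only [mem_union, mem_singleton] at hw
  omega

theorem le_add_three (c : Config R n a r k) {u v w : ℕ} (hu : r < u) (hv : r < v) (hw : r < w)
    (h : R u v) (h' : R v w) : k w ≤ k u + 3 := by
  have hl := c.lt_of_adj _ _ h
  have hl' := c.lt_of_adj _ _ h'
  have hne : u ≠ v := by rintro rfl; exact c.not_adj_self _ h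
  have hne' : v ≠ w := by rintro rfl; exact c.not_adj_self _ h'
  have hne'' : u ≠ w := by rintro rfl; exact c.asymm _ _ h h'
  refine c.le_of_path (((HamPath.single u).cat (HamPath.single v) (by simpa using hne) h).cat
    (HamPath.single w) (by
      simp only [disjoint_left, mem_union, mem_singleton]; omega) h') ?_
  intro x hx
  simp only [mem_union, mem_singleton] at hx
  omega

/-- The rerouting `0 ⋯ i, j ⋯ q - 1, u ⋯ v, i + 1 ⋯ p, q ⋯ r` skips the `j - p - 1` vertices
strictly between `p` and `j` and gains `j - p` off the path. -/
theorem not_adj_of_path (c : Config R n a r k) {s : Finset ℕ} {u v i p j q : ℕ}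
    (h : HamPath R s u v (j - p)) (hs : ∀ w ∈ s, r < w ∧ w ≤ n + a) (hip : i < p) (hpj : p < j)
    (hjq : j < q) (hq : q ≤ r) (hu : k u < q) (hv : i + 1 < k v) (h1 : R i j) : ¬ R p q := by
  intro h2
  obtain ⟨hu1, hu2⟩ := hs u h.left_mem
  obtain ⟨hv1, hv2⟩ := hs v h.right_mem
  have p1 := (c.Icc_path (Nat.zero_le i) (by omega)).cat (c.Icc_path (i := j) (j := q - 1)
    (by omega) (by omega)) (by simp only [disjoint_left, mem_Icc]; omega) h1
  have p2 := p1.cat h (by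
    simp only [disjoint_left, mem_union, mem_Icc]
    intro x hx hxs
    have := (hs x hxs).1
    omega) (c.adj_of_le u hu1 hu2 _ (by omega) (by omega))
  have p3 := p2.cat (c.Icc_path (i := i + 1) (j := p) (by omega) (by omega)) (by
    simp only [disjoint_left, mem_union, mem_Icc]
    rintro x (hx | hx)
    · omega
    · have := (hs x hx).1
      omega) (c.adj_of_lt v hv1 hv2 _ (by omega) (by omega))
  have p4 := p3.cat (c.Icc_path (i := q) (j := r) (by omega) le_rfl) (by
    simp only [disjoint_left, mem_union, mem_Icc]
    rintro x ((hx | hx) | hx)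
    · omega
    · have := (hs x hx).1
      omega
    · omega) h2
  exact c.no_path _ (p4.congr rfl (by omega))


/-! ### Degree sums, and the exclusion of threshold `0` -/

theorem mul_le_arcs (c : Config R n a r k) {s : Finset ℕ} (hs : ∀ x ∈ s, x ≤ n + a) :
    a * s.card ≤ arcs R s (range (n + a + 1)) := by
  unfold arcs
  rw [mul_comm, ← smul_eq_mul, ← sum_const]
  exact sum_le_sum fun x hx => c.le_out x (hs x hx)

theorem mul_le_arcs_right (c : Config R n a r k) {s : Finset ℕ} (hs : ∀ x ∈ s, x ≤ n + a) :
    a * s.card ≤ arcs R (range (n + a + 1)) s := by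
  rw [arcs_comm, mul_comm, ← smul_eq_mul, ← sum_const]
  exact sum_le_sum fun x hx => c.le_in x (hs x hx)

theorem out_add_in (c : Config R n a r k) {u : ℕ} (hu : u ≤ n + a) :
    ((range (n + a + 1)).filter (R u)).card + ((range (n + a + 1)).filter (R · u)).card = n + a := by
  rw [← card_union_of_disjoint]
  · have : ((range (n + a + 1)).filter (R u)) ∪ ((range (n + a + 1)).filter (R · u)) =
        (range (n + a + 1)).erase u := by
      ext x
      simp only [mem_union, mem_filter, mem_range, mem_erase]
      constructor
      · rintro (⟨h1, h2⟩ | ⟨h1, h2⟩)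
        · exact ⟨by rintro rfl; exact c.not_adj_self _ h2, h1⟩
        · exact ⟨by rintro rfl; exact c.not_adj_self _ h2, h1⟩
      · rintro ⟨h1, h2⟩
        rcases c.total u x hu (by omega) (Ne.symm h1) with h | h
        · exact Or.inl ⟨h2, h⟩
        · exact Or.inr ⟨h2, h⟩
    rw [this, card_erase_of_mem (by simp; omega)]
    simp
  · rw [disjoint_left]
    intro x hx hx'
    rw [mem_filter] at hx hx'
    exact c.asymm _ _ hx.2 hx'.2

theorem arcs_le_mul_out (c : Config R n a r k) {s : Finset ℕ} (hs : ∀ x ∈ s, x ≤ n + a) :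
    arcs R s (range (n + a + 1)) ≤ n * s.card := by
  unfold arcs
  rw [mul_comm, ← smul_eq_mul, ← sum_const]
  refine sum_le_sum fun x hx => ?_
  have := c.out_add_in (hs x hx)
  have := c.le_in x (hs x hx)
  omega

theorem two_arcs (c : Config R n a r k) {s : Finset ℕ} (hs : ∀ x ∈ s, x ≤ n + a) :
    2 * arcs R s s + s.card = s.card * s.card :=
  two_mul_arcs_self (fun u _ v _ => c.asymm u v)
    (fun u hu v hv => c.total u v (hs u hu) (hs v hv))

theorem arcs_swap (c : Config R n a r k) {s t : Finset ℕ} (hs : ∀ x ∈ s, x ≤ n + a)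
    (ht : ∀ x ∈ t, x ≤ n + a) (hst : Disjoint s t) :
    arcs R s t + arcs R t s = s.card * t.card :=
  arcs_add_swap (fun u _ v _ => c.asymm u v)
    (fun u hu v hv => c.total u v (hs u hu) (ht v hv)
      (fun h => (disjoint_left.1 hst) hu (h ▸ hv)))

/-- With `Z` the vertices of threshold `0` and `Y` their other out-neighbours, all out-arcs of `Z`
end in `Z ∪ Y`, so `2 * a + 1 ≤ |Z| + 2 * |Y|`; the outdegree of `0` gives `a ≤ r + |Z|`. Add the
two. -/
theorem exists_reached_from_zero (c : Config R n a r k) {w₀ : ℕ} (hw : r < w₀) (hw' : w₀ ≤ n + a)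
    (hk : k w₀ = 0) : ∃ U ⊆ Ioc r (n + a),
      (∀ w ∈ U, k w = 0 ∨ ∃ u ∈ Ioc r (n + a), k u = 0 ∧ R u w) ∧ 3 * a + 1 ≤ 2 * U.card + r := by
  have hrN := c.r_lt
  set W := Ioc r (n + a) with hW
  have hWm : ∀ x, x ∈ W ↔ r < x ∧ x ≤ n + a := fun x => by simp [hW]
  set Z := W.filter (k · = 0) with hZ
  set Y := W.filter (fun w => k w ≠ 0 ∧ ∃ u ∈ W, k u = 0 ∧ R u w) with hY
  have hZm : ∀ x, x ∈ Z ↔ (r < x ∧ x ≤ n + a) ∧ k x = 0 := fun x => by simp [hZ, hWm]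
  have hd : Disjoint Z Y := by
    simp only [disjoint_left, hZ, hY, mem_filter]
    tauto
  refine ⟨Z ∪ Y, union_subset (filter_subset _ _) (filter_subset _ _), ?_, ?_⟩
  · intro w hw
    simp only [hZ, hY, mem_union, mem_filter] at hw
    tauto
  have hZb : ∀ x ∈ Z, x ≤ n + a := fun x hx => ((hZm x).1 hx).1.2
  have h1 := c.mul_le_arcs hZb
  have h2 := c.two_arcs hZb
  have h3 : arcs R Z (range (n + a + 1)) = arcs R Z (Z ∪ Y) := by
    unfold arcs
    refine sum_congr rfl fun u hu => ?_
    congr 1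
    ext x
    have hu' := (hZm u).1 hu
    simp only [mem_filter, mem_range, mem_union, hY, hZm, hWm]
    constructor
    · rintro ⟨hx, hux⟩
      have : r < x := by
        by_contra hc
        have := c.lt_of_adj_right hu'.1.1 hu'.1.2 (by omega) hux
        omega
      by_cases hkx : k x = 0
      · exact ⟨Or.inl ⟨by omega, hkx⟩, hux⟩
      · exact ⟨Or.inr ⟨by omega, hkx, u, hu'.1, hu'.2, hux⟩, hux⟩
    · rintro ⟨_, hux⟩
      have := c.lt_of_adj _ _ hux
      exact ⟨by omega, hux⟩
  rw [arcs_union_right hd] at h3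
  have h4 := arcs_le_mul (R := R) (s := Z) (t := Y)
  have h5 : a ≤ r + Z.card := by
    refine (c.le_out 0 (by omega)).trans ?_
    calc _ ≤ (Icc 1 r ∪ Z).card := card_le_card fun x hx => by
          simp only [mem_filter, mem_range] at hx
          simp only [mem_union, mem_Icc, hZm]
          have h0 : x ≠ 0 := by rintro rfl; exact c.not_adj_self _ hx.2
          by_cases hxr : x ≤ r
          · left; omega
          · have := c.le_of_adj_left (by omega) (by omega) (Nat.zero_le r) hx.2
            right; omega
      _ ≤ r + Z.card := (card_union_le _ _).trans (by simp)
  have hpos : 0 < Z.card := card_pos.2 ⟨w₀, (hZm _).2 ⟨⟨hw, hw'⟩, hk⟩⟩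
  rw [card_union_of_disjoint hd]
  have h6 : 2 * a * Z.card ≤ (Z.card + 2 * Y.card - 1) * Z.card := by
    zify [show 1 ≤ Z.card + 2 * Y.card by omega]
    zify at *
    nlinarith
  have h7 := Nat.le_of_mul_le_mul_right h6 hpos
  omega

/-- Along one, two or three off-path vertices the threshold cannot climb from `0` to `r + 1 ≥ 4`, so
`U` and its mirror image `V` are disjoint, and together they exceed the `n + a - r` vertices off the
path. -/
theorem not_zero_and_succ (c : Config R n a r k) {w₀ w₁ : ℕ} (hw₀ : r < w₀) (hw₀' : w₀ ≤ n + a)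
    (hk₀ : k w₀ = 0) (hw₁ : r < w₁) (hw₁' : w₁ ≤ n + a) (hk₁ : k w₁ = r + 1) : False := by
  obtain ⟨U, hU, hU', hUc⟩ := c.exists_reached_from_zero hw₀ hw₀' hk₀
  obtain ⟨V, hV, hV', hVc⟩ := c.reverse.exists_reached_from_zero hw₁ hw₁' (by omega)
  have hr := c.three_le
  have hrN := c.r_lt
  have hd : Disjoint U V := by
    rw [disjoint_left]
    intro x hxU hxV
    have hx := mem_Ioc.1 (hU hxU)
    have hkx := c.k_le x
    rcases hU' x hxU with h1 | ⟨u, hu, hku, h1⟩ <;> rcases hV' x hxV with h2 | ⟨v, hv, hkv, h2⟩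
    · omega
    · rw [mem_Ioc] at hv
      rw [flip_of_gt hx.1, flip_of_gt hv.1] at h2
      have := c.le_add_two hx.1 hv.1 h2
      omega
    · rw [mem_Ioc] at hu
      have := c.le_add_two hu.1 hx.1 h1
      omega
    · rw [mem_Ioc] at hu hv
      rw [flip_of_gt hx.1, flip_of_gt hv.1] at h2
      have := c.le_add_three hu.1 hx.1 hv.1 h1 h2
      have := c.k_le v
      omega
  have := card_le_card (union_subset hU hV)
  rw [card_union_of_disjoint hd, Nat.card_Ioc] at this
  have := c.le_two_mul
  omega

theorem le_r (c : Config R n a r k) (h : ∀ w, r < w → w ≤ n + a → k w ≤ r) : a ≤ r := by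
  have hrN := c.r_lt
  refine (c.le_in r (by omega)).trans ?_
  calc _ ≤ (range r).card := card_le_card fun x hx => by
        simp only [mem_filter, mem_range] at hx ⊢
        by_contra hc
        have hne : x ≠ r := by rintro rfl; exact c.not_adj_self _ hx.2
        have := c.lt_of_adj_right (by omega) (by omega) le_rfl hx.2
        have := h x (by omega) (by omega)
        omega
    _ = r := card_range r

/-- Eliminating `A`, `S` and `F` leaves the bilinear inequality `key`, which is incompatible with
`h₁ + h₂ ≤ r - 3`. The split at `h₁ = 5` is where the coefficient of `h₂` changes sign. -/
theorem zero_case_arith {r n a F h₁ h₂ A S : ℤ} (hA : 2 * A + (r - 1) = (r - 1) * (r - 1))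
    (hF : a + 1 ≤ F) (hn : n + 2 ≤ 2 * a) (har : a ≤ r) (ha : 4 ≤ a) (h1 : 0 ≤ h₁) (h2 : 0 ≤ h₂)
    (hm : F + h₁ + h₂ = n + a - r)
    (hS : 2 * (a * h₂) + h₂ ≤ 2 * S + 2 * (h₁ * h₂) + h₂ * h₂)
    (hout : A + ((r - 1) * F + (r - 3) * h₁ + S) ≤ n * (r - 1)) : False := by
  have e1 : h₂ * (h₁ + h₂ + r + 3) ≤ h₂ * (2 * a) := mul_le_mul_of_nonneg_left (by linarith) h2
  have e2 : (r - 1) * (h₁ + h₂ + r + 3) ≤ (r - 1) * (2 * a) :=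
    mul_le_mul_of_nonneg_left (by linarith) (by linarith)
  have e3 : (r - 1) * F = (r - 1) * (n + a - r - h₁ - h₂) := by rw [← hm]; ring
  have key : (r - 1) + (r - 5) * h₁ + h₂ * (5 - h₁) ≤ 0 := by nlinarith
  have hh : h₁ + h₂ ≤ r - 3 := by linarith
  rcases le_or_gt h₁ 5 with h5 | h5
  · rcases le_or_gt 5 r with hr5 | hr5
    · nlinarith [mul_nonneg (sub_nonneg.2 hr5) h1, mul_nonneg h2 (sub_nonneg.2 h5)]
    · nlinarith [mul_nonneg h2 (sub_nonneg.2 h5)]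
  · nlinarith [mul_nonneg (show 0 ≤ h₁ - 5 by linarith) (show 0 ≤ r - 5 - h₂ by linarith)]

/-- The vertex `w₀` and its out-neighbours all have threshold at most `2`, so all of `X = [2, r]`
dominates at least `a + 1` vertices off the path. Vertices of `H₂` receive arcs only from `X`, `H₁`
and `H₂`, which forces many more arcs out of `X`, beyond its outdegree sum. -/
theorem not_zero (c : Config R n a r k) {w₀ : ℕ} (hw₀ : r < w₀) (hw₀' : w₀ ≤ n + a)
    (hk₀ : k w₀ = 0) : False := by
  by_cases hK : ∀ w, r < w → w ≤ n + a → k w ≤ r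
  swap
  · push Not at hK
    obtain ⟨w, h1, h2, h3⟩ := hK
    have := c.k_le w
    exact c.not_zero_and_succ hw₀ hw₀' hk₀ h1 h2 (by omega)
  have har := c.le_r hK
  have ha := c.four_le
  have hrN := c.r_lt
  set W := Ioc r (n + a) with hW
  set L := W.filter (k · ≤ 2) with hL
  set H₁ := W.filter (fun w => 3 ≤ k w ∧ k w ≤ 4) with hH₁
  set H₂ := W.filter (5 ≤ k ·) with hH₂
  set X := Icc 2 r with hX
  have hLm : ∀ x, x ∈ L ↔ (r < x ∧ x ≤ n + a) ∧ k x ≤ 2 := fun x => by simp [hL, hW]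
  have hH₁m : ∀ x, x ∈ H₁ ↔ (r < x ∧ x ≤ n + a) ∧ 3 ≤ k x ∧ k x ≤ 4 := fun x => by simp [hH₁, hW]
  have hH₂m : ∀ x, x ∈ H₂ ↔ (r < x ∧ x ≤ n + a) ∧ 5 ≤ k x := fun x => by simp [hH₂, hW]
  have hWeq : W = L ∪ (H₁ ∪ H₂) := by
    ext x
    rw [mem_union, mem_union, hLm, hH₁m, hH₂m, hW, mem_Ioc]
    omega
  have d1 : Disjoint L (H₁ ∪ H₂) := by
    simp only [disjoint_left, mem_union, hLm, hH₁m, hH₂m]; omega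
  have d2 : Disjoint H₁ H₂ := by
    simp only [disjoint_left, hH₁m, hH₂m]; omega
  have hcard : L.card + (H₁.card + H₂.card) = n + a - r := by
    rw [← card_union_of_disjoint d2, ← card_union_of_disjoint d1, ← hWeq, hW, Nat.card_Ioc]
  have hF : a + 1 ≤ L.card := by
    have hmem : w₀ ∈ L := (hLm _).2 ⟨⟨hw₀, hw₀'⟩, by omega⟩
    have : a ≤ (L.erase w₀).card := by
      refine (c.le_out w₀ hw₀').trans (card_le_card fun x hx => ?_)
      simp only [mem_filter, mem_range] at hx
      have hne : x ≠ w₀ := by rintro rfl; exact c.not_adj_self _ hx.2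
      have hxr : r < x := by
        by_contra hcon
        have := c.lt_of_adj_right hw₀ hw₀' (by omega) hx.2
        omega
      have := c.le_add_two hw₀ hxr hx.2
      exact mem_erase.2 ⟨hne, (hLm _).2 ⟨by omega, by omega⟩⟩
    have := card_erase_add_one hmem
    omega
  have hXc : X.card = r - 1 := by simp [hX]
  have hXb : ∀ x ∈ X, x ≤ n + a := fun x hx => by rw [hX, mem_Icc] at hx; omega
  have h1 := c.arcs_le_mul_out hXb
  have h2 := c.two_arcs hXb
  have dXW : Disjoint X W := by
    simp only [disjoint_left, hX, hW, mem_Icc, mem_Ioc]; omega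
  have h3 : arcs R X (X ∪ W) ≤ arcs R X (range (n + a + 1)) := arcs_mono Subset.rfl fun x hx => by
    simp only [hX, hW, mem_union, mem_Icc, mem_Ioc, mem_range] at hx ⊢; omega
  rw [arcs_union_right dXW, hWeq, arcs_union_right d1, arcs_union_right d2] at h3
  have h4 : arcs R X L = X.card * L.card := arcs_eq_mul fun u hu v hv => by
    have hv' := (hLm v).1 hv
    rw [hX, mem_Icc] at hu
    exact c.adj_of_le v hv'.1.1 hv'.1.2 u (by omega) (by omega)
  have h5 : arcs R (Icc 4 r) H₁ = (Icc 4 r).card * H₁.card := arcs_eq_mul fun u hu v hv => by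
    have hv' := (hH₁m v).1 hv
    rw [mem_Icc] at hu
    exact c.adj_of_le v hv'.1.1 hv'.1.2 u (by omega) (by omega)
  have h5' : arcs R (Icc 4 r) H₁ ≤ arcs R X H₁ :=
    arcs_mono (Icc_subset_Icc_left (by omega)) Subset.rfl
  have hH₂b : ∀ x ∈ H₂, x ≤ n + a := fun x hx => ((hH₂m x).1 hx).1.2
  have h6 := c.mul_le_arcs_right hH₂b
  have h7 := c.two_arcs hH₂b
  have hreq : range (n + a + 1) = Icc 0 1 ∪ X ∪ W := by
    ext x; simp only [hX, hW, mem_union, mem_Icc, mem_Ioc, mem_range]; omega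
  have d3 : Disjoint (Icc 0 1) X := by
    simp only [disjoint_left, hX, mem_Icc]; omega
  have d4 : Disjoint (Icc 0 1 ∪ X) W := by
    simp only [disjoint_left, hX, hW, mem_union, mem_Icc, mem_Ioc]; omega
  rw [hreq, arcs_union_left d4, arcs_union_left d3, hWeq, arcs_union_left d1,
    arcs_union_left d2] at h6
  have h8 : arcs R (Icc 0 1) H₂ = 0 := arcs_eq_zero fun u hu v hv h => by
    have hv' := (hH₂m v).1 hv
    rw [mem_Icc] at hu
    have := c.le_of_adj_left hv'.1.1 hv'.1.2 (by omega) h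
    omega
  have h9 : arcs R L H₂ = 0 := arcs_eq_zero fun u hu v hv h => by
    have hv' := (hH₂m v).1 hv
    have hu' := (hLm u).1 hu
    have := c.le_add_two hu'.1.1 hv'.1.1 h
    omega
  have h10 := arcs_le_mul (R := R) (s := H₁) (t := H₂)
  rw [hXc] at h1 h2 h4
  rw [Nat.card_Icc] at h5
  rw [h4] at h3
  rw [h8, h9] at h6
  have hn := c.le_two_mul
  have h5'' : ((r : ℤ) - 3) * H₁.card ≤ arcs R X H₁ := by
    have : (((r + 1 - 4 : ℕ) : ℤ)) = (r : ℤ) - 3 := by omega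
    rw [← this]; exact_mod_cast h5 ▸ h5'
  have hr1 : ((r - 1 : ℕ) : ℤ) = (r : ℤ) - 1 := by omega
  have hcard' : (L.card : ℤ) + H₁.card + H₂.card = n + a - r := by omega
  refine zero_case_arith (r := r) (n := n) (a := a) (F := L.card) (h₁ := H₁.card) (h₂ := H₂.card)
    (A := arcs R X X) (S := arcs R X H₂) ?_ (by exact_mod_cast hF) (by exact_mod_cast hn)
    (by exact_mod_cast har) (by exact_mod_cast ha) (Int.natCast_nonneg _) (Int.natCast_nonneg _) hcard' ?_ ?_
  · rw [← hr1]; exact_mod_cast h2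
  · zify at *; nlinarith
  · zify at h1 h3
    rw [hr1] at h1 h3
    linarith

theorem one_le (c : Config R n a r k) {w : ℕ} (hw : r < w) (hw' : w ≤ n + a) : 1 ≤ k w := by
  by_contra h
  exact c.not_zero hw hw' (by omega)

theorem le_length (c : Config R n a r k) {w : ℕ} (hw : r < w) (hw' : w ≤ n + a) : k w ≤ r := by
  have := c.reverse.one_le hw hw'
  omega

end Config

/-- Every finite nonempty tournament has a Hamiltonian path. -/
theorem HamPath.exists_of_nonempty {R : ℕ → ℕ → Prop} {s : Finset ℕ} (hs : s.Nonempty)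
    (htot : ∀ x ∈ s, ∀ y ∈ s, x ≠ y → R x y ∨ R y x) : ∃ u v, HamPath R s u v s.card := by
  let closed : Finset (Finset ℕ) := s.powerset.filter fun Z =>
    Z.Nonempty ∧ ∀ z ∈ Z, ∀ v ∈ s, v ∉ Z → ¬ R z v
  obtain ⟨Z₀, hZ₀, hmin⟩ := exists_min_image closed card ⟨s, by
    simp only [closed, mem_filter, mem_powerset]
    exact ⟨Subset.rfl, hs, fun z _ v hv hv' => absurd hv hv'⟩⟩
  simp only [closed, mem_filter, mem_powerset] at hZ₀ hmin
  obtain ⟨hsub, ⟨u, hu⟩, hZcl⟩ := hZ₀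
  obtain ⟨v, hv⟩ := HamPath.exists_ending_at _ s u rfl (hsub hu) htot (by
    intro Z hZ hZn huZ
    by_contra hcon
    push Not at hcon
    by_cases hint : (Z ∩ Z₀).Nonempty
    · have := hmin (Z ∩ Z₀) ⟨inter_subset_left.trans hZ, hint, by
        intro z hz w hw hwZ
        rw [mem_inter] at hz
        by_cases hwZ' : w ∈ Z
        · exact hZcl z hz.2 w hw fun h => hwZ (mem_inter.2 ⟨hwZ', h⟩)
        · exact hcon z hz.1 w hw hwZ'⟩
      have heq : Z ∩ Z₀ = Z₀ := eq_of_subset_of_card_le inter_subset_right this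
      exact huZ (inter_subset_left (heq ▸ hu))
    · obtain ⟨z, hz⟩ := hZn
      have hzZ₀ : z ∉ Z₀ := fun h => hint ⟨z, mem_inter.2 ⟨hz, h⟩⟩
      rcases htot z (hZ hz) u (hsub hu) (fun h => huZ (h ▸ hz)) with h | h
      · exact hcon z hz u (hsub hu) huZ h
      · exact hZcl u hu z (hZ hz) hzZ₀ h)
  exact ⟨v, u, hv⟩

/-! ### The exclusion of thresholds `1` and `2` -/

namespace Config

variable {R : ℕ → ℕ → Prop} {n a r : ℕ} {k : ℕ → ℕ}

theorem exists_path_of_le_card (c : Config R n a r k) {S : Finset ℕ} (hS : ∀ x ∈ S, x ≤ n + a)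
    {t : ℕ} (ht : 1 ≤ t) (htS : t ≤ S.card) : ∃ s ⊆ S, ∃ u v, HamPath R s u v t := by
  obtain ⟨s, hs, hst⟩ := exists_subset_card_eq htS
  obtain ⟨u, v, h⟩ := HamPath.exists_of_nonempty (R := R) (card_pos.1 (by omega : 0 < s.card))
    (fun x hx y hy => c.total x y (hS x (hs hx)) (hS y (hs hy)))
  exact ⟨s, hs, u, v, h.congr rfl hst⟩

theorem a_le_r (c : Config R n a r k) : a ≤ r := c.le_r fun _ h h' => c.le_length h h'

theorem adj_zero (c : Config R n a r k) {w : ℕ} (hw : r < w) (hw' : w ≤ n + a) : R w 0 :=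
  c.adj_of_lt w hw hw' 0 (by omega) (c.one_le hw hw')

theorem adj_last (c : Config R n a r k) {w : ℕ} (hw : r < w) (hw' : w ≤ n + a) : R r w :=
  c.adj_of_le w hw hw' r le_rfl (c.le_length hw hw')

theorem le_of_adj_zero (c : Config R n a r k) {x : ℕ} (h : R 0 x) : x ≤ r := by
  by_contra hx
  exact c.asymm _ _ h (c.adj_zero (by omega) (c.lt_of_adj _ _ h).2)

theorem lt_of_adj_last (c : Config R n a r k) {x : ℕ} (h : R x r) : x < r := by
  by_contra hx
  rcases Nat.lt_or_ge r x with hx' | hx'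
  · exact c.asymm _ _ h (c.adj_last hx' (c.lt_of_adj _ _ h).1)
  · obtain rfl : x = r := by omega
    exact c.not_adj_self _ h

theorem le_card_out_zero (c : Config R n a r k) :
    a ≤ ((Icc 2 (r - 1)).filter (R 0)).card + 2 := by
  have hr := c.three_le
  calc a ≤ _ := c.le_out 0 (by omega)
    _ ≤ ((Icc 2 (r - 1)).filter (R 0) ∪ {1, r}).card := card_le_card fun x hx => by
      simp only [mem_filter, mem_range] at hx
      have h1 := c.le_of_adj_zero hx.2
      have h0 : x ≠ 0 := by rintro rfl; exact c.not_adj_self _ hx.2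
      by_cases hx1 : x = 1 ∨ x = r
      · exact mem_union_right _ (by simpa using hx1)
      · exact mem_union_left _ (by simp only [mem_filter, mem_Icc]; exact ⟨by omega, hx.2⟩)
    _ ≤ _ := (card_union_le _ _).trans (Nat.add_le_add_left card_le_two _)

theorem le_card_in_last (c : Config R n a r k) :
    a ≤ ((Icc 1 (r - 2)).filter (R · r)).card + 2 := by
  have hr := c.three_le
  have hrN := c.r_lt
  calc a ≤ _ := c.le_in r (by omega)
    _ ≤ ((Icc 1 (r - 2)).filter (R · r) ∪ {0, r - 1}).card := card_le_card fun x hx => by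
      simp only [mem_filter, mem_range] at hx
      have h1 := c.lt_of_adj_last hx.2
      by_cases hx1 : x = 0 ∨ x = r - 1
      · exact mem_union_right _ (by simpa using hx1)
      · exact mem_union_left _ (by simp only [mem_filter, mem_Icc]; exact ⟨by omega, hx.2⟩)
    _ ≤ _ := (card_union_le _ _).trans (Nat.add_le_add_left card_le_two _)

/-- The out-neighbours of `0` and the successors of the in-neighbours of `r` are disjoint inside
`[2, r - 1]` by `not_adj_pred`, and each kind numbers at least `a - 2`. -/
theorem two_mul_le (c : Config R n a r k) {w : ℕ} (hw : r < w) (hw' : w ≤ n + a) (h2 : 2 ≤ k w)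
    (hk : k w < r) : 2 * a ≤ r + 2 := by
  have hr := c.three_le
  have h1 := c.le_card_out_zero
  have h3 := c.le_card_in_last
  set C := (Icc 2 (r - 1)).filter (R 0) with hC
  set I := (Icc 1 (r - 2)).filter (R · r) with hI
  have hd : Disjoint C (I.image (· + 1)) := by
    simp only [disjoint_left, hC, hI, mem_image, mem_filter, mem_Icc]
    rintro x hx ⟨y, hy, rfl⟩
    exact c.not_adj_pred hw hw' (i := 0) (j := y + 1) (q := r) (by omega) (by omega) (by omega) hk
      le_rfl hx.2 hy.2
  have hsub : C ∪ I.image (· + 1) ⊆ Icc 2 (r - 1) := by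
    intro x
    simp only [hC, hI, mem_union, mem_image, mem_filter, mem_Icc]
    rintro (h | ⟨y, hy, rfl⟩) <;> omega
  have := card_le_card hsub
  rw [card_union_of_disjoint hd, card_image_of_injective _ (add_left_injective 1),
    Nat.card_Icc] at this
  omega

theorem low_case_arith {a z μ A : ℕ} (hz : 3 ≤ z) (hzμ : z + μ ≤ a) (hA : 2 * A + z = z * z)
    (h : a * z ≤ 1 + z + A + μ * (z - 1)) : False := by
  obtain ⟨y, rfl⟩ : ∃ y, z = y + 1 := ⟨z - 1, by omega⟩
  rw [Nat.add_sub_cancel] at h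
  have h1 := Nat.mul_le_mul_right (y + 1) hzμ
  nlinarith

/-- The off-path paths of every length up to `|L|` feed `not_adj_of_path`: if `0 → j`, no `p < j`
with `j - p ≤ |L|` dominates anything beyond `j`. So an in-neighbour of `r` lies either after an
out-neighbour of `0` or far before it. The far case fails by tight cardinalities; otherwise the part
of the path beyond the last out-neighbour of `0` receives too few arcs. -/
theorem not_many_low (c : Config R n a r k) {L : Finset ℕ} (hL : ∀ w ∈ L, r < w ∧ w ≤ n + a)
    (hLk : ∀ w ∈ L, k w ≤ 4) (hLa : a ≤ L.card + 1)
    (hpath : ∀ t, 1 ≤ t → t ≤ L.card → ∃ s u v, HamPath R s u v t ∧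
      (∀ w ∈ s, r < w ∧ w ≤ n + a) ∧ k u ≤ 3 ∧ 2 ≤ k v) : False := by
  have ha := c.four_le
  have har := c.a_le_r
  have hn := c.le_two_mul
  have hrN := c.r_lt
  have hr2 : 2 * a ≤ r + 2 := by
    obtain ⟨s, u, v, h, hs, h1, h2⟩ := hpath 1 le_rfl (by omega)
    have hsc := h.card_eq
    obtain ⟨x, rfl⟩ := card_eq_one.1 hsc
    have hu := h.left_mem
    have hv := h.right_mem
    rw [mem_singleton] at hu hv
    subst hu; subst hv
    obtain ⟨h3, h4⟩ := hs v h.left_mem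
    exact c.two_mul_le h3 h4 h2 (by omega)
  have hLm : L.card ≤ n + a - r := by
    have : L ⊆ Ioc r (n + a) := fun x hx => mem_Ioc.2 (hL x hx)
    simpa using card_le_card this
  have h1 := c.le_card_out_zero
  have h3 := c.le_card_in_last
  set C := (Icc 2 (r - 1)).filter (R 0) with hC
  set I := (Icc 1 (r - 2)).filter (R · r) with hI
  have hCm : ∀ x, x ∈ C ↔ (2 ≤ x ∧ x ≤ r - 1) ∧ R 0 x := fun x => by simp [hC]
  have hIm : ∀ x, x ∈ I ↔ (1 ≤ x ∧ x ≤ r - 2) ∧ R x r := fun x => by simp [hI]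
  have hrule : ∀ p j q, 1 ≤ p → p < j → j < q → q ≤ r → 4 ≤ q → j - p ≤ L.card → R 0 j →
      ¬ R p q := by
    intro p j q hp hpj hjq hq hq4 ht h0
    obtain ⟨s, u, v, h, hs, hu, hv⟩ := hpath (j - p) (by omega) ht
    exact c.not_adj_of_path h hs (i := 0) (by omega) hpj hjq hq (by omega) (by omega) h0
  have hgap : ∀ x ∈ I, ∀ j ∈ C, x < j → L.card + x < j := by
    intro x hx j hj hxj
    rw [hIm] at hx; rw [hCm] at hj
    by_contra hcon
    exact hrule x j r hx.1.1 hxj (by omega) le_rfl (by omega) (by omega) hj.2 hx.2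
  by_cases hcross : ∃ x ∈ I, ∃ j ∈ C, x < j
  · obtain ⟨x, hx, j, hj, hxj⟩ := hcross
    have hg := hgap x hx j hj hxj
    have hx' := (hIm x).1 hx
    have hj' := (hCm j).1 hj
    have hIsub : I ⊆ Icc 1 (j - L.card - 1) ∪ Icc j (r - 2) := by
      intro y hy
      have hy' := (hIm y).1 hy
      rw [mem_union, mem_Icc, mem_Icc]
      by_cases hyj : y < j
      · have := hgap y hy j hj hyj
        left; omega
      · right; omega
    have hcU : (Icc 1 (j - L.card - 1) ∪ Icc j (r - 2)).card ≤ r - 2 - L.card := by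
      refine (card_union_le _ _).trans ?_
      rw [Nat.card_Icc, Nat.card_Icc]
      omega
    have hIc := card_le_card hIsub
    -- The bounds leave no slack, so `I` is the whole union and contains `1`. This in turn
    -- determines `C`, whose gaps then reduce `I` to `{1}`, although `|I| ≥ a - 2 ≥ 2`.
    have hIeq := eq_of_subset_of_card_le hIsub (by omega)
    have h1I : 1 ∈ I := by
      rw [hIeq, mem_union, mem_Icc]
      left; omega
    have hCsub : C ⊆ Icc (L.card + 2) (r - 1) := by
      intro y hy
      have hy' := (hCm y).1 hy
      have := hgap 1 h1I y hy (by omega)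
      rw [mem_Icc]; omega
    have hCeq := eq_of_subset_of_card_le hCsub (by rw [Nat.card_Icc]; omega)
    have hCa : a + 1 ∈ C := by rw [hCeq, mem_Icc]; omega
    have hCr : r - 1 ∈ C := by rw [hCeq, mem_Icc]; omega
    have hI1 : I ⊆ {1} := by
      intro y hy
      have hy' := (hIm y).1 hy
      rw [mem_singleton]
      by_cases hya : y < a + 1
      · have := hgap y hy _ hCa hya
        omega
      · have := hgap y hy _ hCr (by omega)
        omega
    have := card_le_card hI1
    rw [card_singleton] at this
    omega
  · push Not at hcross
    have hCne : C.Nonempty := card_pos.1 (by omega)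
    have hjC := C.max'_mem hCne
    have hjmax := C.le_max'
    set j := C.max' hCne with hjdef
    have hj' := (hCm j).1 hjC
    have hCj : C ⊆ Icc 2 j := fun x hx => by
      have := hjmax x hx
      have := (hCm x).1 hx
      rw [mem_Icc]; omega
    have hCc := card_le_card hCj
    rw [Nat.card_Icc] at hCc
    have hIj : I ⊆ Icc j (r - 2) := fun x hx => by
      have := hcross x hx j hjC
      have := (hIm x).1 hx
      rw [mem_Icc]; omega
    have hIc := card_le_card hIj
    rw [Nat.card_Icc] at hIc
    set Z := Icc (j + 1) r with hZ
    have hZc : Z.card = r - j := by simp [hZ]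
    have hZb : ∀ x ∈ Z, x ≤ n + a := fun x hx => by rw [hZ, mem_Icc] at hx; omega
    have e1 := c.mul_le_arcs_right hZb
    have e2 := c.two_arcs hZb
    set Q := Ioc r (n + a) \ L with hQ
    have hQm : ∀ x, x ∈ Q ↔ (r < x ∧ x ≤ n + a) ∧ x ∉ L := fun x => by simp [hQ]
    have hLsub : L ⊆ Ioc r (n + a) := fun x hx => mem_Ioc.2 (hL x hx)
    have hQc : Q.card = n + a - r - L.card := by
      rw [hQ, card_sdiff_of_subset hLsub, Nat.card_Ioc]
    have hsub : range (n + a + 1) ⊆ {0} ∪ Icc 1 (j - 1) ∪ {j} ∪ Z ∪ L ∪ Q := by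
      intro x hx
      simp only [mem_union, mem_singleton, mem_Icc, hQm, hZ, mem_range] at hx ⊢
      by_cases hxL : x ∈ L <;> simp [hxL]; omega
    have e3 := arcs_mono (R := R) hsub (Subset.refl Z)
    have key : ∀ s t : Finset ℕ, arcs R (s ∪ t) Z ≤ arcs R s Z + arcs R t Z := by
      intro s t
      rw [← union_sdiff_self_eq_union, arcs_union_left disjoint_sdiff]
      exact Nat.add_le_add_left (arcs_mono sdiff_subset Subset.rfl) _
    have k1 := key ({0} ∪ Icc 1 (j - 1) ∪ {j} ∪ Z ∪ L) Q
    have k2 := key ({0} ∪ Icc 1 (j - 1) ∪ {j} ∪ Z) L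
    have k3 := key ({0} ∪ Icc 1 (j - 1) ∪ {j}) Z
    have k4 := key ({0} ∪ Icc 1 (j - 1)) {j}
    have k5 := key {0} (Icc 1 (j - 1))
    have f1 : arcs R {0} Z ≤ 1 := by
      rw [arcs_singleton_left]
      refine (card_le_card (t := {r}) fun x hx => ?_).trans (card_singleton r).le
      rw [mem_filter, hZ, mem_Icc] at hx
      rw [mem_singleton]
      by_contra hxr
      have := hjmax x ((hCm x).2 ⟨by omega, hx.2⟩)
      omega
    have f2 : arcs R (Icc 1 (j - 1)) Z = 0 := arcs_eq_zero fun p hp q hq => by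
      rw [mem_Icc] at hp
      rw [hZ, mem_Icc] at hq
      exact hrule p j q hp.1 (by omega) (by omega) hq.2 (by omega) (by omega) hj'.2
    have f3 : arcs R {j} Z ≤ Z.card := arcs_le_mul.trans (by simp)
    have f4 : arcs R L Z = 0 := arcs_eq_zero fun w hw q hq h => by
      rw [hZ, mem_Icc] at hq
      obtain ⟨h1, h2⟩ := hL w hw
      have := c.lt_of_adj_right h1 h2 (by omega) h
      have := hLk w hw
      omega
    have f5 : arcs R Q Z ≤ Q.card * (Z.card - 1) := by
      have : arcs R Q Z = arcs R Q (Icc (j + 1) (r - 1)) + arcs R Q {r} := by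
        rw [← arcs_union_right (by
          simp only [disjoint_left, mem_Icc, mem_singleton]; omega)]
        congr 1
        ext x; simp only [hZ, mem_union, mem_Icc, mem_singleton]; omega
      rw [this, arcs_eq_zero (s := Q) (t := {r})]
      · refine arcs_le_mul.trans (Nat.mul_le_mul_left _ ?_)
        rw [Nat.card_Icc]; omega
      · intro w hw q hq h
        rw [mem_singleton] at hq
        subst hq
        have hw' := (hQm w).1 hw
        exact c.asymm _ _ h (c.adj_last hw'.1.1 hw'.1.2)
    have total : a * Z.card ≤ 1 + Z.card + arcs R Z Z + Q.card * (Z.card - 1) := by omega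
    exact low_case_arith (by omega) (by omega) e2 total

/-- Out-arcs of the vertices of threshold `1` end in `0`, `L₁` or `L₂`. Counting them makes `L₂`
large enough for `not_many_low`. -/
theorem two_le (c : Config R n a r k) {w : ℕ} (hw : r < w) (hw' : w ≤ n + a) : 2 ≤ k w := by
  by_contra hcon
  have hk1 : k w = 1 := by have := c.one_le hw hw'; omega
  have ha := c.four_le
  have har := c.a_le_r
  have hn := c.le_two_mul
  have hrN := c.r_lt
  set W := Ioc r (n + a) with hW
  set L₁ := W.filter (k · = 1) with hL₁
  set L₂ := W.filter (fun w => 2 ≤ k w ∧ k w ≤ 3) with hL₂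
  have hL₁m : ∀ x, x ∈ L₁ ↔ (r < x ∧ x ≤ n + a) ∧ k x = 1 := fun x => by simp [hL₁, hW]
  have hL₂m : ∀ x, x ∈ L₂ ↔ (r < x ∧ x ≤ n + a) ∧ 2 ≤ k x ∧ k x ≤ 3 := fun x => by simp [hL₂, hW]
  have hd : Disjoint L₁ L₂ := by simp only [disjoint_left, hL₁m, hL₂m]; omega
  have hcard : L₁.card + L₂.card ≤ n + a - r := by
    rw [← card_union_of_disjoint hd]
    simpa [hW] using card_le_card (union_subset (filter_subset (k · = 1) W)
      (filter_subset (fun w => 2 ≤ k w ∧ k w ≤ 3) W))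
  have hb : ∀ x ∈ L₁, x ≤ n + a := fun x hx => ((hL₁m x).1 hx).1.2
  have h1 := c.mul_le_arcs hb
  have h2 := c.two_arcs hb
  have h3 : arcs R L₁ (range (n + a + 1)) ≤ arcs R L₁ ({0} ∪ (L₁ ∪ L₂)) := by
    unfold arcs
    refine sum_le_sum fun u hu => card_le_card fun x hx => ?_
    have hu' := (hL₁m u).1 hu
    simp only [mem_filter, mem_range, mem_union, mem_singleton, hL₁m, hL₂m] at hx ⊢
    refine ⟨?_, hx.2⟩
    by_cases hxr : x ≤ r
    · have := c.lt_of_adj_right hu'.1.1 hu'.1.2 hxr hx.2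
      left; omega
    · have := c.le_add_two hu'.1.1 (by omega) hx.2
      have := c.one_le (w := x) (by omega) (by omega)
      right; omega
  have hd' : Disjoint {0} (L₁ ∪ L₂) := by
    simp only [disjoint_left, mem_union, mem_singleton, hL₁m, hL₂m]; omega
  rw [arcs_union_right hd', arcs_union_right hd] at h3
  have h4 := arcs_le_mul (R := R) (s := L₁) (t := {0})
  have h5 := arcs_le_mul (R := R) (s := L₁) (t := L₂)
  have hpos : 0 < L₁.card := card_pos.2 ⟨w, (hL₁m _).2 ⟨⟨hw, hw'⟩, hk1⟩⟩
  rw [card_singleton] at h4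
  have h6 : 2 * a * L₁.card ≤ (1 + L₁.card + 2 * L₂.card) * L₁.card := by nlinarith
  have h7 := Nat.le_of_mul_le_mul_right h6 hpos
  have h8 : 2 * a ≤ r + 2 := by
    obtain ⟨x, hx⟩ : L₂.Nonempty := card_pos.1 (by omega)
    have hx' := (hL₂m x).1 hx
    exact c.two_mul_le hx'.1.1 hx'.1.2 hx'.2.1 (by omega)
  refine c.not_many_low (L := L₂) (fun x hx => ((hL₂m x).1 hx).1)
    (fun x hx => by have := (hL₂m x).1 hx; omega) (by omega) fun t ht htc => ?_
  obtain ⟨s, hs, u, v, h⟩ := c.exists_path_of_le_card (S := L₂)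
    (fun x hx => ((hL₂m x).1 hx).1.2) ht htc
  exact ⟨s, u, v, h, fun x hx => ((hL₂m x).1 (hs hx)).1, ((hL₂m u).1 (hs h.left_mem)).2.2,
    ((hL₂m v).1 (hs h.right_mem)).2.1⟩

theorem card_out_le (c : Config R n a r k) {w : ℕ} (hw : r < w) (hw' : w ≤ n + a) :
    a ≤ k w + ((Ioc r (n + a)).filter (R w)).card := by
  calc a ≤ _ := c.le_out w hw'
    _ ≤ (range (k w) ∪ (Ioc r (n + a)).filter (R w)).card := card_le_card fun x hx => by
      simp only [mem_filter, mem_range, mem_union, mem_Ioc] at hx ⊢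
      by_cases hxr : x ≤ r
      · left; exact c.lt_of_adj_right hw hw' hxr hx.2
      · right; exact ⟨by omega, hx.2⟩
    _ ≤ _ := (card_union_le _ _).trans (by simp)

/-- `not_many_low` applies to `w` with its off-path out-neighbours. Paths with at least two vertices
start at `w`, which keeps the initial threshold at `2`. -/
theorem three_le_k (c : Config R n a r k) {w : ℕ} (hw : r < w) (hw' : w ≤ n + a) : 3 ≤ k w := by
  by_contra hcon
  have hk2 : k w = 2 := by have := c.two_le hw hw'; omega
  have hc := c.card_out_le hw hw'
  set N := (Ioc r (n + a)).filter (R w) with hN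
  have hNm : ∀ x, x ∈ N ↔ (r < x ∧ x ≤ n + a) ∧ R w x := fun x => by simp [hN]
  have hwN : w ∉ N := fun h => c.not_adj_self _ ((hNm w).1 h).2
  refine c.not_many_low (L := insert w N) ?_ ?_ ?_ fun t ht htc => ?_
  · intro x hx
    rcases mem_insert.1 hx with rfl | hx
    · exact ⟨hw, hw'⟩
    · exact ((hNm x).1 hx).1
  · intro x hx
    rcases mem_insert.1 hx with rfl | hx
    · omega
    · have hx' := (hNm x).1 hx
      have := c.le_add_two hw hx'.1.1 hx'.2
      omega
  · rw [card_insert_of_notMem hwN]; omega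
  · rw [card_insert_of_notMem hwN] at htc
    rcases Nat.lt_or_ge 1 t with h1 | h1
    · obtain ⟨s, hs, u, v, h⟩ := c.exists_path_of_le_card (S := N) (t := t - 1)
        (fun x hx => ((hNm x).1 hx).1.2) (by omega) (by omega)
      refine ⟨{w} ∪ s, w, v, ((HamPath.single w).cat h ?_ ((hNm u).1 (hs h.left_mem)).2).congr rfl
        (by omega), ?_, by omega, ?_⟩
      · rw [disjoint_singleton_left]
        exact fun h => hwN (hs h)
      · intro x hx
        rcases mem_union.1 hx with hx | hx
        · rw [mem_singleton.1 hx]; exact ⟨hw, hw'⟩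
        · exact ((hNm x).1 (hs hx)).1
      · have := (hNm v).1 (hs h.right_mem)
        exact c.two_le this.1.1 this.1.2
    · obtain rfl : t = 1 := by omega
      exact ⟨{w}, w, w, HamPath.single w, by simp; omega, by omega, by omega⟩

theorem k_add_two_le (c : Config R n a r k) {w : ℕ} (hw : r < w) (hw' : w ≤ n + a) :
    k w + 2 ≤ r := by
  have := c.reverse.three_le_k hw hw'
  omega

/-! ### Strong connectivity of the low segment -/

/-- Sum outdegrees over `Z`: there are `|Z| (|Z| - 1) / 2` arcs inside and at most `|Z| |T|`
leaving. Vertices whose out-arcs are confined cannot be few. -/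
theorem two_mul_add_one_le (c : Config R n a r k) {Z T : Finset ℕ} (hZ : Z.Nonempty)
    (hb : ∀ u ∈ Z, u ≤ n + a) (h : ∀ u ∈ Z, ∀ x, R u x → x ∈ Z ∨ x ∈ T) :
    2 * a + 1 ≤ Z.card + 2 * T.card := by
  have h1 := c.mul_le_arcs hb
  have h2 := c.two_arcs hb
  have h3 : arcs R Z (range (n + a + 1)) ≤ arcs R Z (Z ∪ T) := by
    unfold arcs
    refine sum_le_sum fun u hu => card_le_card fun x hx => ?_
    rw [mem_filter] at hx ⊢
    exact ⟨mem_union.2 (h u hu x hx.2), hx.2⟩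
  rw [← union_sdiff_self_eq_union, arcs_union_right disjoint_sdiff] at h3
  have h4 : arcs R Z (T \ Z) ≤ Z.card * T.card :=
    arcs_le_mul.trans (Nat.mul_le_mul_left _ (card_le_card sdiff_subset))
  have h5 : (2 * a + 1) * Z.card ≤ (Z.card + 2 * T.card) * Z.card := by nlinarith
  exact Nat.le_of_mul_le_mul_right h5 (card_pos.2 hZ)

theorem two_mul_add_one_lt (c : Config R n a r k) {Z T : Finset ℕ}
    (hb : ∀ u ∈ Z, u ≤ n + a) (h : ∀ u ∈ Z, ∀ x, R u x → x ∈ Z ∨ x ∈ T)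
    {t u : ℕ} (ht : t ∈ T) (htZ : t ∉ Z) (hu : u ∈ Z) (htu : R t u) :
    2 * a + 1 < Z.card + 2 * T.card := by
  have h1 := c.mul_le_arcs hb
  have h2 := c.two_arcs hb
  have h3 : arcs R Z (range (n + a + 1)) ≤ arcs R Z (Z ∪ T) := by
    unfold arcs
    refine sum_le_sum fun u hu => card_le_card fun x hx => ?_
    rw [mem_filter] at hx ⊢
    exact ⟨mem_union.2 (h u hu x hx.2), hx.2⟩
  rw [← union_sdiff_self_eq_union, arcs_union_right disjoint_sdiff] at h3
  have htm : t ∈ T \ Z := mem_sdiff.2 ⟨ht, htZ⟩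
  rw [← insert_erase htm, insert_eq, arcs_union_right (by simp)] at h3
  have h4 : arcs R Z ((T \ Z).erase t) ≤ Z.card * (T.card - 1) := by
    refine arcs_le_mul.trans (Nat.mul_le_mul_left _ ?_)
    rw [card_erase_of_mem htm]
    exact Nat.sub_le_sub_right (card_le_card sdiff_subset) 1
  have h5 : arcs R Z {t} + 1 ≤ Z.card := by
    rw [arcs_singleton_right, ← card_erase_add_one hu]
    refine Nat.add_le_add_right (card_le_card fun x hx => ?_) 1
    rw [mem_filter] at hx
    refine mem_erase.2 ⟨?_, hx.1⟩
    rintro rfl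
    exact c.asymm _ _ hx.2 htu
  obtain ⟨b, hb'⟩ : ∃ b, T.card = b + 1 := ⟨T.card - 1, by have := card_pos.2 ⟨t, ht⟩; omega⟩
  rw [hb'] at h4 ⊢
  rw [Nat.add_sub_cancel] at h4
  have h6 : (2 * a + 1) * Z.card < (Z.card + 2 * (b + 1)) * Z.card := by nlinarith
  exact lt_of_mul_lt_mul_right h6 (Nat.zero_le _)

theorem k_le_n (c : Config R n a r k) {w : ℕ} (hw : r < w) (hw' : w ≤ n + a) : k w ≤ n := by
  have h1 := c.out_add_in hw'
  have h2 := c.le_in w hw'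
  have h3 : (range (k w)).card ≤ ((range (n + a + 1)).filter (R w)).card :=
    card_le_card fun x hx => by
      have := c.k_le w
      have := c.r_lt
      rw [mem_range] at hx
      rw [mem_filter, mem_range]
      exact ⟨by omega, c.adj_of_lt w hw hw' x (by omega) hx⟩
  rw [card_range] at h3
  omega

theorem le_r_of_adj (c : Config R n a r k) {w₀ : ℕ}
    (hmin : ∀ w, r < w → w ≤ n + a → k w₀ ≤ k w) {i x : ℕ} (hi : i < k w₀) (h : R i x) :
    x ≤ r := by
  by_contra hx
  have hl := c.lt_of_adj _ _ h
  have := hmin x (by omega) hl.2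
  have := c.k_le w₀
  by_cases hir : i ≤ r
  · exact c.asymm _ _ h (c.adj_of_lt x (by omega) hl.2 i hir (by omega))
  · omega

/-- The initial segment `[1, k w₀ - 1]` of the path is strongly connected. -/
theorem exists_adj_back (c : Config R n a r k) {w₀ : ℕ} (hw : r < w₀) (hw' : w₀ ≤ n + a)
    (hmin : ∀ w, r < w → w ≤ n + a → k w₀ ≤ k w) (h4 : 4 ≤ k w₀) {z : ℕ} (hz1 : 1 < z)
    (hz2 : z ≤ k w₀ - 1) : ∃ u v, z ≤ u ∧ u ≤ k w₀ - 1 ∧ 1 ≤ v ∧ v < z ∧ R u v := by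
  have hrN := c.r_lt
  have hkr := c.k_add_two_le hw hw'
  have hkn := c.k_le_n hw hw'
  have hn := c.le_two_mul
  have ha := c.four_le
  set κ := k w₀ with hκ
  have hP : ∀ i x, i < κ → R i x → x ≤ r := fun i x hi h => c.le_r_of_adj hmin hi h
  by_contra hcon
  have hback : ∀ u v, z ≤ u → u ≤ κ - 1 → 1 ≤ v → v < z → ¬ R u v := fun u v h1 h2 h3 h4 h5 =>
    hcon ⟨u, v, h1, h2, h3, h4, h5⟩
  have hfwd : ∀ u v, z ≤ u → u ≤ κ - 1 → 1 ≤ v → v < z → R v u := fun u v h1 h2 h3 h4 =>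
    c.adj_of_not (by omega) (by omega) (by omega) (hback u v h1 h2 h3 h4)
  -- At a cut every forward arc is present, in particular `1 → i + 1`; this chord stops `i` from
  -- dominating anything beyond `κ`.
  have hdead : ∀ i q, 2 ≤ i → z ≤ i + 1 → i ≤ κ - 2 → κ < q → ¬ R i q := by
    intro i q h1 h2 h3 h4 h
    have := hP _ _ (by omega) h
    exact c.not_adj_pred hw hw' (i := 1) (j := i + 1) (q := q) (by omega) (by omega) (by omega)
      (by omega) (by omega) (hfwd _ _ h2 (by omega) le_rfl hz1) h
  by_cases hs : z ≤ κ - 2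
  · by_cases hhit : ∃ i, i ≤ κ - 2 ∧ R i κ
    · obtain ⟨i, hi, hiκ⟩ := hhit
      have := c.two_mul_add_one_le (Z := Icc z (κ - 1)) (T := {0, κ}) ⟨z, by simp; omega⟩
        (fun u hu => by rw [mem_Icc] at hu; omega) fun u hu x hux => by
          rw [mem_Icc] at hu
          simp only [mem_Icc, mem_insert, mem_singleton]
          have := hP u x (by omega) hux
          by_cases hx0 : x = 0
          · omega
          by_cases hxz : x < z
          · exact absurd hux (hback u x hu.1 hu.2 (by omega) hxz)
          by_cases hxκ : κ < x
          · rcases Nat.lt_or_ge (κ - 2) u with hu' | hu'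
            · obtain rfl : u = κ - 1 := by omega
              exact absurd hux (c.not_adj_pred hw hw' (i := i) (j := κ) (q := x) (by omega)
                (by omega) (by omega) (by omega) (by omega) hiκ)
            · exact absurd hux (hdead u x (by omega) (by omega) hu' hxκ)
          omega
      have h2 := card_le_two (a := 0) (b := κ)
      rw [Nat.card_Icc] at this
      omega
    · push Not at hhit
      have := c.two_mul_add_one_le (Z := Icc z (κ - 2)) (T := {0, κ - 1}) ⟨z, by simp; omega⟩
        (fun u hu => by rw [mem_Icc] at hu; omega) fun u hu x hux => by
          rw [mem_Icc] at hu
          simp only [mem_Icc, mem_insert, mem_singleton]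
          have := hP u x (by omega) hux
          by_cases hx0 : x = 0
          · omega
          by_cases hxz : x < z
          · exact absurd hux (hback u x hu.1 (by omega) (by omega) hxz)
          by_cases hxκ : κ < x
          · exact absurd hux (hdead u x (by omega) (by omega) hu.2 hxκ)
          by_cases hxκ' : x = κ
          · subst hxκ'
            exact absurd hux (hhit u hu.2)
          omega
      have h2 := card_le_two (a := 0) (b := κ - 1)
      rw [Nat.card_Icc] at this
      omega
  · obtain rfl : z = κ - 1 := by omega
    have hex : ∃ q, κ < q ∧ R (κ - 1) q := by
      by_contra hno
      push Not at hno
      have := c.two_mul_add_one_le (Z := {κ - 1}) (T := {0, κ}) (by simp)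
        (fun u hu => by rw [mem_singleton] at hu; omega) fun u hu x hux => by
          rw [mem_singleton] at hu
          subst hu
          simp only [mem_insert, mem_singleton]
          by_cases hx0 : x = 0
          · omega
          by_cases hxz : x < κ - 1
          · exact absurd hux (hback _ x le_rfl le_rfl (by omega) hxz)
          by_cases hxκ : κ < x
          · exact absurd hux (hno x hxκ)
          omega
      have h2 := card_le_two (a := 0) (b := κ)
      rw [card_singleton] at this
      omega
    obtain ⟨q, hq, hqκ⟩ := hex
    have hqr := hP _ _ (by omega) hqκ
    have hhit : ∀ i, i ≤ κ - 2 → ¬ R i κ := fun i hi h =>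
      c.not_adj_pred hw hw' (i := i) (j := κ) (q := q) (by omega) (by omega) (by omega) (by omega)
        hqr h hqκ
    -- `P y` says that no arc of `[2, κ - 2]` goes back across `y`, vacuously for `y = 2`. Beyond
    -- the greatest such `y` there is no further cut, so each `u ∈ [y, κ - 2]` ends a Hamiltonian
    -- path of `[2, κ - 2]`, and the detour along `1 → κ - 1` stops `u` from dominating anything
    -- beyond `κ`.
    let P : ℕ → Prop := fun y => 2 ≤ y ∧ y ≤ κ - 2 ∧
      ∀ u v, y ≤ u → u ≤ κ - 2 → 2 ≤ v → v < y → ¬ R u v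
    have hP2 : P 2 := ⟨le_rfl, by omega, fun u v _ _ _ _ => by omega⟩
    obtain ⟨hy2, hyκ, hyc⟩ := Nat.findGreatest_spec (P := P) (n := κ - 2) (by omega) hP2
    have hmax : ∀ y, Nat.findGreatest P (κ - 2) < y → y ≤ κ - 2 → ¬ P y := fun y h1 h2 =>
      Nat.findGreatest_is_greatest h1 h2
    set y := Nat.findGreatest P (κ - 2) with hy
    have hdead' : ∀ u x, y ≤ u → u ≤ κ - 2 → κ < x → ¬ R u x := by
      intro u x hu1 hu2 hx h
      have hxr := hP _ _ (by omega) h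
      obtain ⟨s, hs1, hs2, hham⟩ := HamPath.exists_Icc_ending_at (R := R) (i := 2) (j := κ - 2)
        (t := u) (by omega) hu2 (fun x _ hx => c.step x (by omega)) (fun x hx y hy =>
          c.total x y (by rw [mem_Icc] at hx; omega) (by rw [mem_Icc] at hy; omega)) (by
            intro z' hz1 hz2
            by_contra hcon'
            push Not at hcon'
            exact hmax z' (by omega) hz2 ⟨by omega, hz2, fun u' v' h1 h2 h3 h4 =>
              hcon' u' v' h1 h2 h3 h4⟩)
      exact c.not_adj_of_detour hw hw' (i := 1) (j := κ - 1) (q := x) (s := s) (u := u) (by omega)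
        (by omega) (by omega) hxr (hfwd _ _ le_rfl le_rfl le_rfl (by omega))
        (hham.congr rfl (by omega)) (by omega) h
    have hout : ∀ u ∈ Icc y (κ - 2), ∀ x, R u x → x ∈ Icc y (κ - 2) ∨ x ∈ ({0, 1, κ - 1} : Finset ℕ) := by
      intro u hu x hux
      rw [mem_Icc] at hu
      simp only [mem_Icc, mem_insert, mem_singleton]
      by_cases hx1 : x ≤ 1
      · omega
      by_cases hxz : x < y
      · exact absurd hux (hyc u x hu.1 (by omega) (by omega) hxz)
      by_cases hxκ : κ < x
      · exact absurd hux (hdead' u x hu.1 hu.2 hxκ)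
      by_cases hxκ' : x = κ
      · subst hxκ'
        exact absurd hux (hhit u hu.2)
      omega
    have h3 := card_le_three (a := 0) (b := 1) (c := κ - 1)
    -- For `y = 2` the plain count is off by one; the arc `1 → 2` entering the set supplies the
    -- strict inequality.
    by_cases hy3 : y = 2
    · have := c.two_mul_add_one_lt (fun u hu => by rw [mem_Icc] at hu; omega) hout (t := 1) (u := 2)
        (by simp) (by rw [mem_Icc]; omega) (by rw [mem_Icc]; omega) (c.step 1 (by omega))
      rw [Nat.card_Icc] at this
      omega
    · have := c.two_mul_add_one_le ⟨y, by rw [mem_Icc]; omega⟩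
        (fun u hu => by rw [mem_Icc] at hu; omega) hout
      rw [Nat.card_Icc] at this
      omega

/-- For `k w₀ = 3` the low segment is the single arc `1 → 2`, not strongly connected; this is the
source of the second alternative. -/
theorem exists_path_to_last (c : Config R n a r k) {w₀ : ℕ} (hw : r < w₀) (hw' : w₀ ≤ n + a)
    (hmin : ∀ w, r < w → w ≤ n + a → k w₀ ≤ k w) {p : ℕ} (hp1 : 1 ≤ p) (hp2 : p < k w₀)
    (hp : R p r) : (∃ u v, HamPath R (Icc 1 (k w₀ - 1)) u v (k w₀ - 1) ∧ R v r) ∨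
      (k w₀ = 3 ∧ R 1 r ∧ R r 2) := by
  have h3 := c.three_le_k hw hw'
  have hkr := c.k_add_two_le hw hw'
  have hrN := c.r_lt
  rcases Nat.lt_or_ge 3 (k w₀) with h4 | h4
  · left
    obtain ⟨u, _, _, hu⟩ := HamPath.exists_Icc_ending_at (R := R) (i := 1) (j := k w₀ - 1) (t := p)
      hp1 (by omega) (fun x _ hx => c.step x (by omega)) (fun x hx y hy =>
        c.total x y (by rw [mem_Icc] at hx; omega) (by rw [mem_Icc] at hy; omega))
      (fun z hz1 hz2 => c.exists_adj_back hw hw' hmin h4 (by omega) hz2)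
    exact ⟨u, p, hu.congr rfl (by omega), hp⟩
  · have h3 : k w₀ = 3 := by omega
    by_cases h2 : R 2 r
    · left
      refine ⟨1, 2, ?_, h2⟩
      rw [h3]
      exact c.Icc_path (by omega) (by omega)
    · right
      have hp1 : p = 1 := by
        by_contra hne
        obtain rfl : p = 2 := by omega
        exact h2 hp
      subst hp1
      exact ⟨h3, hp, c.adj_of_not (by omega) (by omega) (by omega) h2⟩

theorem exists_path_from_zero (c : Config R n a r k) {w₁ : ℕ} (hw : r < w₁) (hw' : w₁ ≤ n + a)
    (hmax : ∀ w, r < w → w ≤ n + a → k w ≤ k w₁) {q : ℕ} (hq1 : k w₁ ≤ q) (hq2 : q < r)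
    (hq : R 0 q) : (∃ u v, HamPath R (Icc (k w₁) (r - 1)) u v (r - k w₁) ∧ R 0 u) ∨
      (k w₁ + 2 = r ∧ R 0 (r - 1) ∧ R (r - 2) 0) := by
  have hkr := c.k_add_two_le hw hw'
  have h := c.reverse.exists_path_to_last hw hw'
    (fun w h1 h2 => by have := hmax w h1 h2; omega) (p := r - q) (by omega) (by omega)
    (by rw [flip_of_le le_rfl, flip_of_le (by omega), Nat.sub_self, Nat.sub_sub_self hq2.le]
        exact hq)
  rcases h with ⟨u, v, h1, h2⟩ | ⟨h1, h2, h3⟩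
  · left
    have huv := h1.right_mem
    rw [mem_Icc] at huv
    have h4 := h1.reverse_image (flip_injective r)
    refine ⟨_, _, h4.congr ?_ (by omega), ?_⟩
    · ext x
      simp only [mem_image, mem_Icc]
      constructor
      · rintro ⟨y, hy, rfl⟩
        rw [flip_of_le (by omega)]; omega
      · intro hx
        exact ⟨r - x, by omega, by rw [flip_of_le (by omega)]; omega⟩
    · rwa [flip_of_le le_rfl, Nat.sub_self] at h2
  · right
    rw [flip_of_le le_rfl, flip_of_le (by omega), Nat.sub_self] at h2
    rw [flip_of_le le_rfl, flip_of_le (by omega), Nat.sub_self] at h3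
    exact ⟨by omega, h2, h3⟩

/-! ### Exchanging the high and the low segment -/

/-- The concatenation `0, B, M, A, r` is a path: every vertex from `k w₁` on dominates all off-path
vertices, and these dominate everything below `k w₀`. It has `r + 2` vertices. -/
theorem false_of_paths (c : Config R n a r k) {w₀ w₁ : ℕ} (hw₀ : r < w₀) (hw₀' : w₀ ≤ n + a)
    (hw₁ : r < w₁) (hw₁' : w₁ ≤ n + a)
    (hmin : ∀ w, r < w → w ≤ n + a → k w₀ ≤ k w) (hmax : ∀ w, r < w → w ≤ n + a → k w ≤ k w₁)
    {sA sB sM : Finset ℕ} {uA vA uB vB u v lA lB lM : ℕ} (hA : HamPath R sA uA vA lA)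
    (hB : HamPath R sB uB vB lB) (hM : HamPath R sM u v lM) (hsA : sA ⊆ Icc 1 (k w₀ - 1))
    (hsB : sB ⊆ Icc (k w₁) (r - 1))
    (hsM : ∀ x ∈ sM, (r < x ∧ x ≤ n + a) ∨ (k w₀ ≤ x ∧ x < k w₁)) (hu : r < u) (hv : r < v)
    (h0 : R 0 uB) (hr : R vA r) (hl : lA + lB + lM = r) : False := by
  have h3 := c.three_le_k hw₀ hw₀'
  have hkr := c.k_add_two_le hw₁ hw₁'
  have hk := hmin w₁ hw₁ hw₁'
  have hsA' : ∀ x ∈ sA, 1 ≤ x ∧ x ≤ k w₀ - 1 := fun x hx => mem_Icc.1 (hsA hx)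
  have hsB' : ∀ x ∈ sB, k w₁ ≤ x ∧ x ≤ r - 1 := fun x hx => mem_Icc.1 (hsB hx)
  have hu' : u ≤ n + a := by have := hsM u hM.left_mem; omega
  have hv' : v ≤ n + a := by have := hsM v hM.right_mem; omega
  have hvB := hsB' _ hB.right_mem
  have huA := hsA' _ hA.left_mem
  have hku := hmax u hu hu'
  have hkv := hmin v hv hv'
  have p1 := (HamPath.single 0).cat hB (by
    rw [disjoint_singleton_left]
    intro h; have := hsB' _ h; omega) h0
  have p2 := p1.cat hM (by
    simp only [disjoint_left, mem_union, mem_singleton]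
    intro x hx hxM
    have := hsM x hxM
    rcases hx with rfl | hx
    · omega
    · have := hsB' _ hx; omega) (c.adj_of_le u hu hu' _ (by omega) (by omega))
  have p3 := p2.cat hA (by
    simp only [disjoint_left, mem_union, mem_singleton]
    intro x hx hxA
    have := hsA' x hxA
    rcases hx with (rfl | hx) | hx
    · omega
    · have := hsB' _ hx; omega
    · have := hsM x hx; omega) (c.adj_of_lt v hv hv' _ (by omega) (by omega))
  have p4 := p3.cat (HamPath.single r) (by
    simp only [disjoint_left, mem_union, mem_singleton]
    intro x hx hxr
    subst hxr
    rcases hx with ((hx | hx) | hx) | hx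
    · omega
    · have := hsB' _ hx; omega
    · have := hsM _ hx; omega
    · have := hsA' _ hx; omega) hr
  exact c.no_path _ (p4.congr rfl (by omega))

theorem exists_pair (c : Config R n a r k) {u v : ℕ} (hu : r < u) (hu' : u ≤ n + a) (hv : r < v)
    (hv' : v ≤ n + a) (huv : u ≠ v) :
    ∃ s x y, HamPath R s x y 2 ∧ r < x ∧ r < y ∧ ∀ z ∈ s, r < z ∧ z ≤ n + a := by
  have h : ∀ u v, r < u → u ≤ n + a → r < v → v ≤ n + a → u ≠ v → R u v →
      ∃ s x y, HamPath R s x y 2 ∧ r < x ∧ r < y ∧ ∀ z ∈ s, r < z ∧ z ≤ n + a := by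
    intro u v hu hu' hv hv' huv h
    refine ⟨_, u, v, (HamPath.single u).cat (HamPath.single v) (by simpa using huv) h, hu, hv, ?_⟩
    intro z hz
    rw [mem_union, mem_singleton, mem_singleton] at hz
    omega
  rcases c.total u v hu' hv' huv with h1 | h1
  · exact h u v hu hu' hv hv' huv h1
  · exact h v u hv hv' hu hu' huv.symm h1

theorem exists_middle (c : Config R n a r k) {w₀ w₁ : ℕ} (hw₀ : r < w₀) (hw₀' : w₀ ≤ n + a)
    (hw₁ : r < w₁) (hw₁' : w₁ ≤ n + a) {i j : ℕ} (hi : k w₀ ≤ i) (hij : i ≤ j) (hj : j < k w₁) :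
    ∃ s, HamPath R s w₁ w₀ (j + 3 - i) ∧
      ∀ x ∈ s, (r < x ∧ x ≤ n + a) ∨ (k w₀ ≤ x ∧ x < k w₁) := by
  have hkr := c.k_add_two_le hw₁ hw₁'
  refine ⟨_, (((HamPath.single w₁).cat (c.Icc_path hij (by omega)) ?_
    (c.adj_of_lt w₁ hw₁ hw₁' i (by omega) (by omega))).cat (HamPath.single w₀) ?_
    (c.adj_of_le w₀ hw₀ hw₀' j (by omega) (by omega))).congr rfl (by omega), ?_⟩
  · simp only [disjoint_left, mem_singleton, mem_Icc]; omega
  · simp only [disjoint_left, mem_union, mem_singleton, mem_Icc]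
    rintro x (rfl | hx) rfl <;> omega
  · intro x hx
    simp only [mem_union, mem_singleton, mem_Icc] at hx
    omega

/-- One vertex more than the middle segment `[k w₀, k w₁ - 1]`: drop its first vertex and enclose
the rest between `w₁` and `w₀`. For a segment with at most one vertex, off-path vertices alone
suffice. -/
theorem exists_middle_path (c : Config R n a r k) {w₀ w₁ : ℕ} (hw₀ : r < w₀) (hw₀' : w₀ ≤ n + a)
    (hw₁ : r < w₁) (hw₁' : w₁ ≤ n + a) (hk : k w₀ ≤ k w₁) :
    ∃ s u v, HamPath R s u v (k w₁ + 1 - k w₀) ∧ r < u ∧ r < v ∧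
      ∀ x ∈ s, (r < x ∧ x ≤ n + a) ∨ (k w₀ ≤ x ∧ x < k w₁) := by
  rcases Nat.lt_or_ge (k w₀ + 1) (k w₁) with h1 | h1
  · obtain ⟨s, hs, hs'⟩ := c.exists_middle hw₀ hw₀' hw₁ hw₁' (i := k w₀ + 1) (j := k w₁ - 1)
      (by omega) (by omega) (by omega)
    exact ⟨s, w₁, w₀, hs.congr rfl (by omega), hw₁, hw₀, hs'⟩
  · rcases Nat.lt_or_ge (k w₀) (k w₁) with h2 | h2
    · obtain ⟨s, x, y, h, hx, hy, hs⟩ := c.exists_pair hw₀ hw₀' hw₁ hw₁' (by rintro rfl; omega)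
      exact ⟨s, x, y, h.congr rfl (by omega), hx, hy, fun z hz => Or.inl (hs z hz)⟩
    · refine ⟨_, w₀, w₀, (HamPath.single w₀).congr rfl (by omega), hw₀, hw₀, fun x hx => ?_⟩
      rw [mem_singleton] at hx
      omega

/-- The additional vertex compensates for a low or high segment that is only half used in the
exceptional alternative. -/
theorem exists_long_middle_path (c : Config R n a r k) {w₀ w₁ : ℕ} (hw₀ : r < w₀)
    (hw₀' : w₀ ≤ n + a) (hw₁ : r < w₁) (hw₁' : w₁ ≤ n + a) (hk : k w₀ ≤ k w₁) (hm : r + 2 ≤ n + a) :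
    ∃ s u v, HamPath R s u v (k w₁ + 2 - k w₀) ∧ r < u ∧ r < v ∧
      ∀ x ∈ s, (r < x ∧ x ≤ n + a) ∨ (k w₀ ≤ x ∧ x < k w₁) := by
  rcases Nat.lt_or_ge (k w₀) (k w₁) with h1 | h1
  · obtain ⟨s, hs, hs'⟩ := c.exists_middle hw₀ hw₀' hw₁ hw₁' (i := k w₀) (j := k w₁ - 1)
      (by omega) (by omega) (by omega)
    exact ⟨s, w₁, w₀, hs.congr rfl (by omega), hw₁, hw₀, hs'⟩
  · obtain ⟨s, x, y, h, hx, hy, hs⟩ := c.exists_pair (u := r + 1) (v := r + 2) (by omega) (by omega)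
      (by omega) hm (by omega)
    exact ⟨s, x, y, h.congr rfl (by omega), hx, hy, fun z hz => Or.inl (hs z hz)⟩

theorem le_k_add (c : Config R n a r k) {w : ℕ} (hw : r < w) (hw' : w ≤ n + a) :
    a + r + 1 ≤ k w + n + a := by
  have h := c.card_out_le hw hw'
  have hr := c.r_lt
  have h2 : ((Ioc r (n + a)).filter (R w)).card ≤ ((Ioc r (n + a)).erase w).card :=
    card_le_card fun x hx => by
      rw [mem_filter] at hx
      refine mem_erase.2 ⟨?_, hx.1⟩
      rintro rfl
      exact c.not_adj_self _ hx.2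
  rw [card_erase_of_mem (mem_Ioc.2 ⟨hw, hw'⟩), Nat.card_Ioc] at h2
  omega

/-- Here `1 → r` pushes the out-neighbours of `0` in `[2, r - 1]` far up the path, and counting
leaves only `r = 7`, `a = 4`, `n = 5`. There the degrees force `0 → 4` and `3 → 7`, which
`not_adj_pred` forbids. -/
theorem exceptional_case (c : Config R n a r k) {w₀ w₁ : ℕ} (hw₀ : r < w₀) (hw₀' : w₀ ≤ n + a)
    (hw₁ : r < w₁) (hw₁' : w₁ ≤ n + a) (h₀ : k w₀ = 3) (h₁ : k w₁ + 2 = r)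
    (h1r : R 1 r) (hr2 : R r 2) (h0 : R 0 (r - 1)) (h0' : R (r - 2) 0) : False := by
  have hn := c.le_two_mul
  have han := c.a_le
  have ha := c.four_le
  have hrN := c.r_lt
  have har := c.a_le_r
  have hlow := c.le_k_add hw₀ hw₀'
  have h5 := c.three_le_k hw₁ hw₁'
  have hC := c.le_card_out_zero
  have hI := c.le_card_in_last
  have hgap : ∀ p j, 1 ≤ p → p < j → j < r → R 0 j → R p r → n + a < j - p + r := by
    intro p j hp hpj hjr h1 h2
    by_contra hcon
    obtain ⟨s, hs, u, v, h⟩ := c.exists_path_of_le_card (S := Ioc r (n + a)) (t := j - p)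
      (fun x hx => (mem_Ioc.1 hx).2) (by omega) (by rw [Nat.card_Ioc]; omega)
    have hu := mem_Ioc.1 (hs h.left_mem)
    have hv := mem_Ioc.1 (hs h.right_mem)
    have := c.k_add_two_le hu.1 hu.2
    have := c.three_le_k hv.1 hv.2
    exact c.not_adj_of_path h (fun w hw => mem_Ioc.1 (hs hw)) (i := 0) (by omega) hpj hjr le_rfl
      (by omega) (by omega) h1 h2
  have hCsub : (Icc 2 (r - 1)).filter (R 0) ⊆ insert (r - 1) (Icc (n + a + 2 - r) (r - 3)) := by
    intro x hx
    rw [mem_filter, mem_Icc] at hx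
    rw [mem_insert, mem_Icc]
    have := hgap 1 x le_rfl (by omega) (by omega) hx.2 h1r
    by_cases hx1 : x = r - 2
    · subst hx1
      exact absurd h0' (c.asymm _ _ hx.2)
    omega
  have hCc := (card_le_card hCsub).trans (card_insert_le _ _)
  rw [Nat.card_Icc] at hCc
  have hk5 : k w₁ ≤ 5 := by
    by_cases hne : w₁ = w₀
    · rw [hne]; omega
    · have hout := c.card_out_le hw₀ hw₀'
      by_cases hadj : R w₀ w₁
      · have := c.le_add_two hw₀ hw₁ hadj
        omega
      · have : ((Ioc r (n + a)).filter (R w₀)) ⊆ ((Ioc r (n + a)).erase w₀).erase w₁ := by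
          intro x hx
          rw [mem_filter] at hx
          refine mem_erase.2 ⟨?_, mem_erase.2 ⟨?_, hx.1⟩⟩
          · rintro rfl; exact hadj hx.2
          · rintro rfl; exact c.not_adj_self _ hx.2
        have := card_le_card this
        rw [card_erase_of_mem (mem_erase.2 ⟨hne, mem_Ioc.2 ⟨hw₁, hw₁'⟩⟩),
          card_erase_of_mem (mem_Ioc.2 ⟨hw₀, hw₀'⟩), Nat.card_Ioc] at this
        omega
  obtain rfl : r = 7 := by omega
  obtain rfl : a = 4 := by omega
  obtain rfl : n = 5 := by omega
  have h04 : R 0 4 := by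
    by_contra hcon
    have : (Icc 2 (7 - 1)).filter (R 0) ⊆ {6} := by
      intro x hx
      have h1 := hCsub hx
      rw [mem_filter] at hx
      simp only [mem_insert, mem_Icc] at h1
      rw [mem_singleton]
      by_contra hx6
      obtain rfl : x = 4 := by omega
      exact hcon hx.2
    have := card_le_card this
    rw [card_singleton] at this
    omega
  have h37 : R 3 7 := by
    by_contra hcon
    have : (Icc 1 (7 - 2)).filter (R · 7) ⊆ {1} := by
      intro x hx
      rw [mem_filter, mem_Icc] at hx
      have := hgap x 6 (by omega) (by omega) (by omega) h0 hx.2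
      rw [mem_singleton]
      by_contra hx1
      obtain rfl | rfl : x = 2 ∨ x = 3 := by omega
      · exact c.asymm _ _ hr2 hx.2
      · exact hcon hx.2
    have := card_le_card this
    rw [card_singleton] at this
    omega
  exact c.not_adj_pred hw₀ hw₀' (i := 0) (j := 4) (q := 7) (by omega) (by omega) (by omega)
    (by omega) le_rfl h04 h37

theorem not_adj_last_or_not_adj_zero (c : Config R n a r k) {w₀ w₁ : ℕ} (hw₀ : r < w₀) (hw₀' : w₀ ≤ n + a)
    (hw₁ : r < w₁) (hw₁' : w₁ ≤ n + a)
    (hmin : ∀ w, r < w → w ≤ n + a → k w₀ ≤ k w) (hmax : ∀ w, r < w → w ≤ n + a → k w ≤ k w₁) :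
    (∀ p, 1 ≤ p → p < k w₀ → ¬ R p r) ∨ (∀ q, k w₁ ≤ q → q < r → ¬ R 0 q) := by
  by_contra hcon
  push Not at hcon
  obtain ⟨⟨p, hp1, hp2, hp⟩, q, hq1, hq2, hq⟩ := hcon
  have hk := hmin w₁ hw₁ hw₁'
  have h3 := c.three_le_k hw₀ hw₀'
  have hkr := c.k_add_two_le hw₁ hw₁'
  have ha := c.four_le
  have hlow := c.le_k_add hw₀ hw₀'
  have hhigh := c.reverse.le_k_add hw₁ hw₁'
  rcases c.exists_path_to_last hw₀ hw₀' hmin hp1 hp2 hp with ⟨uA, vA, hA, hA'⟩ | ⟨hA1, hA2, hA3⟩ <;>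
    rcases c.exists_path_from_zero hw₁ hw₁' hmax hq1 hq2 hq with
      ⟨uB, vB, hB, hB'⟩ | ⟨hB1, hB2, hB3⟩
  · obtain ⟨s, u, v, hM, hu, hv, hs⟩ := c.exists_middle_path hw₀ hw₀' hw₁ hw₁' hk
    exact c.false_of_paths hw₀ hw₀' hw₁ hw₁' hmin hmax hA hB hM Subset.rfl Subset.rfl hs hu hv hB' hA'
      (by omega)
  · obtain ⟨s, u, v, hM, hu, hv, hs⟩ := c.exists_long_middle_path hw₀ hw₀' hw₁ hw₁' hk (by omega)
    exact c.false_of_paths hw₀ hw₀' hw₁ hw₁' hmin hmax hA (HamPath.single (r - 1)) hM Subset.rfl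
      (by rw [singleton_subset_iff, mem_Icc]; omega) hs hu hv hB2 hA' (by omega)
  · obtain ⟨s, u, v, hM, hu, hv, hs⟩ := c.exists_long_middle_path hw₀ hw₀' hw₁ hw₁' hk (by omega)
    exact c.false_of_paths hw₀ hw₀' hw₁ hw₁' hmin hmax (HamPath.single 1) hB hM
      (by rw [singleton_subset_iff, mem_Icc]; omega) Subset.rfl hs hu hv hB' hA2 (by omega)
  · exact c.exceptional_case hw₀ hw₀' hw₁ hw₁' hA1 hB1 hA2 hA3 hB2 hB3

end Config

/-! ### The final count: some low vertex dominates `r` -/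

section Arithmetic

/-- With `κ = a + x`, the bound for `M` is quadratic in `v`; completing the square with `2 * a - 1 -
x - 4 * v` removes `v`, and `2 * x + 2 ≤ a` finishes. -/
theorem count_arith_hit {a κ d v γ M A n r g : ℤ} (hn : n + 2 ≤ 2 * a) (hr : r + 1 ≤ n + a)
    (hκ : a + 2 * κ ≤ 2 * n + 2) (hv0 : 0 ≤ v) (hd : 2 * a + d < 2 * κ) (hd0 : 0 ≤ d)
    (hγ : γ + a ≤ r - κ + 2) (hg : a ≤ g + d + 2) (hvg : g + v ≤ γ + 1)
    (hM : M ≤ (κ - 2 - d) * v + v * (γ - v) + d) (hA : 2 * A + (κ - 2) = (κ - 2) * (κ - 2))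
    (hlow : a * (κ - 2) + d + (a - 2) ≤ 2 * (κ - 2) + A + M) : False := by
  obtain ⟨x, rfl⟩ : ∃ x, κ = a + x := ⟨κ - a, by ring⟩
  have hx1 : 1 ≤ x := by linarith
  have hx2 : 2 * x + 2 ≤ a := by linarith
  have h1 : v * (a + x - 2 - d + γ - v) ≤ v * (2 * a - 1 - x - 2 * v) :=
    mul_le_mul_of_nonneg_left (by linarith) hv0
  have h2 := sq_nonneg (2 * a - 1 - x - 4 * v)
  have h3 : x * (2 * x + 2) ≤ x * a := mul_le_mul_of_nonneg_left hx2 (by linarith)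
  nlinarith

theorem count_arith_not_hit {a κ d v γ M A n r g : ℤ} (hn : n + 2 ≤ 2 * a) (hr : r + 1 ≤ n + a)
    (hκ : a + 2 * κ ≤ 2 * n + 2) (hv0 : 0 ≤ v) (hd : 2 * a + 1 + d < 2 * κ) (hd0 : 1 ≤ d)
    (hγ : γ + a ≤ r - κ + 1) (hg : a ≤ g + d + 2) (hvg : g + v ≤ γ + 1)
    (hM : M ≤ (κ - 2 - d) * v + v * (γ - v)) (hA : 2 * A + (κ - 2) = (κ - 2) * (κ - 2))
    (hlow : a * (κ - 2) + d ≤ 2 * (κ - 2) + A + M) : False := by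
  obtain ⟨x, rfl⟩ : ∃ x, κ = a + x := ⟨κ - a, by ring⟩
  have hx1 : 1 ≤ x := by linarith
  have hx2 : 2 * x + 2 ≤ a := by linarith
  have h1 : v * (a + x - 2 - d + γ - v) ≤ v * (2 * a - 3 - x - 2 * v) :=
    mul_le_mul_of_nonneg_left (by linarith) hv0
  have h2 := sq_nonneg (2 * a - 3 - x - 4 * v)
  have h3 : x * (2 * x + 2) ≤ x * a := mul_le_mul_of_nonneg_left hx2 (by linarith)
  nlinarith

theorem count_arith_zero {a κ v γ M A n r g : ℤ} (hn : n + 2 ≤ 2 * a) (hr : r + 1 ≤ n + a)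
    (ha : 4 ≤ a) (h3 : 3 ≤ κ) (hrκ : r + 1 ≤ κ + n) (hv1 : 1 ≤ v)
    (hγ : γ + a ≤ r - κ + 1) (hg : a ≤ g + 2) (hvg : g + v ≤ γ + 1)
    (hM : M ≤ (κ - 2) * v + v * (γ - v)) (hA : 2 * A + (κ - 2) = (κ - 2) * (κ - 2))
    (hlow : a * (κ - 2) + 1 ≤ 2 * (κ - 2) + A + M) : False := by
  obtain rfl : γ = a - 2 := by linarith
  obtain rfl : v = 1 := by linarith
  obtain ⟨y, rfl⟩ : ∃ y, κ = y + 2 := ⟨κ - 2, by ring⟩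
  nlinarith [mul_nonneg (show 0 ≤ y - 1 by linarith) (show 0 ≤ a - 2 - y by linarith),
    mul_nonneg (show 0 ≤ y - 1 by linarith) (show 0 ≤ a - 4 by linarith)]

end Arithmetic

namespace Config

variable {R : ℕ → ℕ → Prop} {n a r : ℕ} {k : ℕ → ℕ}

/-- Each vertex of `E` dominates `[0, k w - 2]` and `w`, and has outdegree at most `n`. The arc from
the maximum `j` of `E` to `j + 1` is one more, which improves the bound by one. -/
theorem add_two_mul_le (c : Config R n a r k) {w : ℕ} (hw : r < w) (hw' : w ≤ n + a)
    {E : Finset ℕ} (hE : E.Nonempty) (hEb : ∀ j ∈ E, k w < j ∧ j < r)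
    (hEm : ∀ j ∈ E, ∀ i, i + 2 ≤ k w → ¬ R i j) : E.card + 2 * k w ≤ 2 * n := by
  have hrN := c.r_lt
  have h3 := c.three_le_k hw hw'
  have hb : ∀ x ∈ E, x ≤ n + a := fun x hx => by have := hEb x hx; omega
  have h1 := c.arcs_le_mul_out hb
  have h2 := c.two_arcs hb
  have hmax := E.max'_mem hE
  have hle := E.le_max'
  set j := E.max' hE
  have hj := hEb j hmax
  have hsub : E ∪ (Icc 0 (k w - 2) ∪ ({w} ∪ {j + 1})) ⊆ range (n + a + 1) := by
    intro x hx
    simp only [mem_union, mem_Icc, mem_singleton, mem_range] at hx ⊢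
    rcases hx with hx | hx | hx | hx
    · have := hb x hx; omega
    all_goals omega
  have d1 : Disjoint E (Icc 0 (k w - 2) ∪ ({w} ∪ {j + 1})) := by
    simp only [disjoint_left, mem_union, mem_Icc, mem_singleton]
    intro x hx hx'
    have := hEb x hx
    have := hle x hx
    omega
  have d2 : Disjoint (Icc 0 (k w - 2)) ({w} ∪ {j + 1}) := by
    simp only [disjoint_left, mem_union, mem_Icc, mem_singleton]; omega
  have d3 : Disjoint ({w} : Finset ℕ) {j + 1} := by
    simp only [disjoint_left, mem_singleton]; omega
  have e1 := arcs_mono (R := R) (Subset.refl E) hsub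
  rw [arcs_union_right d1, arcs_union_right d2, arcs_union_right d3] at e1
  have e2 : arcs R E (Icc 0 (k w - 2)) = E.card * (Icc 0 (k w - 2)).card :=
    arcs_eq_mul fun x hx i hi => by
      have := hEb x hx
      rw [mem_Icc] at hi
      exact c.adj_of_not (by omega) (by omega) (by omega) (hEm x hx i (by omega))
  have e3 : arcs R E {w} = E.card * ({w} : Finset ℕ).card := arcs_eq_mul fun x hx y hy => by
    rw [mem_singleton] at hy
    subst hy
    have := hEb x hx
    exact c.adj_of_le y hw hw' x (by omega) (by omega)
  have e4 : 1 ≤ arcs R E {j + 1} := arcs_pos hmax (mem_singleton_self _) (c.step j hj.2)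
  rw [Nat.card_Icc, show k w - 2 + 1 - 0 = k w - 1 by omega] at e2
  rw [card_singleton] at e3
  obtain ⟨b, hb⟩ : ∃ b, k w = b + 1 := ⟨k w - 1, by omega⟩
  rw [show k w - 1 = b by omega] at e2
  rw [hb]
  have h5 : E.card * (E.card + 2 * (b + 1)) < E.card * (2 * n + 1) := by nlinarith
  have := Nat.lt_of_mul_lt_mul_left h5
  omega

/-- If `0 → j` and `p → q` with `p + 2 ≤ k w ≤ j < q`, then `[k w, j]` has at least `p` vertices
dominated by some `i ≤ k w - 2`. -/
theorem le_card_hit (c : Config R n a r k) {w : ℕ} (hw : r < w) (hw' : w ≤ n + a)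
    {C : Finset ℕ} (hC : ∀ x, k w ≤ x → x < r → ∀ i, i + 2 ≤ k w → R i x → x ∈ C) {j p q : ℕ}
    (hj : k w ≤ j) (h0 : R 0 j) (hp : 1 ≤ p) (hpk : p + 2 ≤ k w) (hjq : j < q) (hq : q ≤ r)
    (hpq : R p q)
    (hconn : ∀ t, t < p → t < (C.filter (· ≤ j)).card → R t (k w) →
      ∃ s, s < k w ∧ HamPath R (Icc (t + 1) (k w - 1)) s p (k w - 1 - t)) :
    p ≤ (C.filter (· ≤ j)).card := by
  have hcount : ∀ t, k w + t ≤ j → t < p → (∀ t', t' ≤ t → R t' (j - t')) →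
      t < (C.filter (· ≤ j)).card := by
    intro t ht htp h
    have : (range (t + 1)).image (j - ·) ⊆ C.filter (· ≤ j) := by
      intro x hx
      rw [mem_image] at hx
      obtain ⟨y, hy, rfl⟩ := hx
      rw [mem_range] at hy
      rw [mem_filter]
      exact ⟨hC _ (by omega) (by omega) y (by omega) (h y (by omega)), by omega⟩
    have := card_le_card this
    rw [card_image_of_injOn, card_range] at this
    · omega
    · intro x hx y hy hxy
      simp only [coe_range, Set.mem_Iio] at hx hy
      simp only at hxy
      omega
  -- `adj_succ_pred` turns `0 → j` into `1 → j - 1`, `2 → j - 2`, and so on. If the column came down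
  -- to `k w` at some row `t` with `t + 1 < p`, the path from `hconn` would give a detour
  -- contradicting `p → q`.
  have hchain : ∀ t, t < p → k w + t ≤ j ∧ ∀ t', t' ≤ t → R t' (j - t') := by
    intro t
    induction t with
    | zero =>
      intro _
      refine ⟨by omega, fun t' ht' => ?_⟩
      obtain rfl : t' = 0 := by omega
      exact h0
    | succ t ih =>
      intro ht
      obtain ⟨h1, h2⟩ := ih (by omega)
      have hlt : k w + t < j := by
        by_contra hcon
        have hRt := h2 t le_rfl
        rw [show j - t = k w by omega] at hRt
        obtain ⟨s, hs, hham⟩ := hconn t (by omega) (hcount t h1 (by omega) h2) hRt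
        exact c.not_adj_of_detour hw hw' (i := t) (j := k w) (q := q) (by omega) (by omega)
          (by omega) hq hRt hham hs hpq
      have h3 := c.adj_succ_pred hw hw' (i := t) (j := j - t) (p := p) (q := q) (by omega) hpk
        (by omega) (by omega) (by omega) hq (h2 t le_rfl) hpq
      refine ⟨by omega, fun t' ht' => ?_⟩
      rcases Nat.lt_or_ge t t' with h | h
      · obtain rfl : t' = t + 1 := by omega
        rwa [show j - (t + 1) = j - t - 1 by omega]
      · exact h2 t' h
  obtain ⟨h1, h2⟩ := hchain (p - 1) (by omega)
  have := hcount (p - 1) h1 (by omega) h2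
  omega

/-- If `k w₀` is dominated by some `i ≤ k w₀ - 2`, then the segments `[t + 1, k w₀ - 1]` with
small `t` are strongly connected. -/
theorem exists_path_of_hit (c : Config R n a r k) {w₀ : ℕ} (hw : r < w₀) (hw' : w₀ ≤ n + a)
    (hmin : ∀ w, r < w → w ≤ n + a → k w₀ ≤ k w) {i t p : ℕ} (hi : i + 2 ≤ k w₀)
    (hiκ : R i (k w₀)) (htp : t < p) (hp : p + 2 ≤ k w₀) (ht : k w₀ + t + 1 < 2 * a) :
    ∃ s, s < k w₀ ∧ HamPath R (Icc (t + 1) (k w₀ - 1)) s p (k w₀ - 1 - t) := by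
  have hrN := c.r_lt
  have hkr := c.k_add_two_le hw hw'
  set κ := k w₀ with hκ
  have hP : ∀ i x, i < κ → R i x → x ≤ r := fun i x hi h => c.le_r_of_adj hmin hi h
  obtain ⟨s, hs1, hs2, hs⟩ := HamPath.exists_Icc_ending_at (R := R) (i := t + 1) (j := κ - 1)
    (t := p) (by omega) (by omega) (fun x _ hx => c.step x (by omega)) (fun x hx y hy =>
      c.total x y (by rw [mem_Icc] at hx; omega) (by rw [mem_Icc] at hy; omega)) (by
    intro z hz1 hz2
    by_contra hcon
    have hback : ∀ u v, z ≤ u → u ≤ κ - 1 → t + 1 ≤ v → v < z → ¬ R u v :=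
      fun u v h1 h2 h3 h4 h5 => hcon ⟨u, v, h1, h2, h3, h4, h5⟩
    have := c.two_mul_add_one_le (Z := Icc z (κ - 1)) (T := insert κ (Icc 0 t))
      ⟨z, by rw [mem_Icc]; omega⟩ (fun u hu => by rw [mem_Icc] at hu; omega) fun u hu x hux => by
        rw [mem_Icc] at hu
        simp only [mem_Icc, mem_insert]
        have := hP u x (by omega) hux
        by_cases hxt : x ≤ t
        · omega
        by_cases hxz : x < z
        · exact absurd hux (hback u x hu.1 hu.2 (by omega) hxz)
        by_cases hxκ : κ < x
        · rcases Nat.lt_or_ge (κ - 2) u with hu' | hu'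
          · obtain rfl : u = κ - 1 := by omega
            exact absurd hux (c.not_adj_pred hw hw' (i := i) (j := κ) (q := x) (by omega)
              (by omega) (by omega) (by omega) (by omega) hiκ)
          · refine absurd hux (c.not_adj_pred hw hw' (i := t + 1) (j := u + 1) (q := x) (by omega)
              (by omega) (by omega) (by omega) (by omega) ?_)
            exact c.adj_of_not (by omega) (by omega) (by omega)
              (hback _ _ (by omega) (by omega) le_rfl (by omega))
        omega
    have h2 := card_insert_le κ (Icc 0 t)
    rw [Nat.card_Icc] at this h2
    omega)
  exact ⟨s, by omega, hs.congr rfl (by omega)⟩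

/-- Otherwise the at least `a - 2` columns following in-neighbours of `r` are hit by no row `i ≤ κ -
2`. The few remaining columns `C` are split at the first out-neighbour `j ≥ κ` of `0`; by
`le_card_hit` only the first `|C₁|` rows reach beyond `j`. The resulting bound on `M` contradicts
the outdegrees of the rows in `Q`. -/
theorem exists_adj_last (c : Config R n a r k) {w₀ : ℕ} (hw : r < w₀) (hw' : w₀ ≤ n + a)
    (hmin : ∀ w, r < w → w ≤ n + a → k w₀ ≤ k w) : ∃ p, 1 ≤ p ∧ p < k w₀ ∧ R p r := by
  by_contra hcon
  push Not at hcon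
  have hrN := c.r_lt
  have hkr := c.k_add_two_le hw hw'
  have h3 := c.three_le_k hw hw'
  have hn := c.le_two_mul
  have ha := c.four_le
  have hrκ := c.le_k_add hw hw'
  set κ := k w₀ with hκ
  have hP : ∀ i x, i < κ → R i x → x ≤ r := fun i x hi h => c.le_r_of_adj hmin hi h
  have hself := c.not_adj_self
  -- the in-neighbours of `r`
  set E := (Icc (κ + 1) (r - 1)).filter (fun j => R (j - 1) r) with hE
  have hEm : ∀ x, x ∈ E ↔ (κ + 1 ≤ x ∧ x ≤ r - 1) ∧ R (x - 1) r := fun x => by simp [hE]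
  have hEc : a ≤ E.card + 2 := by
    calc a ≤ _ := c.le_in r (by omega)
      _ ≤ (E.image (· - 1) ∪ {0, r - 1}).card := card_le_card fun x hx => by
        simp only [mem_filter, mem_range] at hx
        have h1 := c.lt_of_adj_last hx.2
        by_cases hx1 : x = 0 ∨ x = r - 1
        · exact mem_union_right _ (by simpa using hx1)
        · refine mem_union_left _ (mem_image.2 ⟨x + 1, (hEm _).2 ⟨?_, by simpa using hx.2⟩, by simp⟩)
          by_contra hxκ
          exact hcon x (by omega) (by omega) hx.2
      _ ≤ E.card + 2 := (card_union_le _ _).trans (Nat.add_le_add card_image_le card_le_two)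
  have hEhit : ∀ j ∈ E, ∀ i, i + 2 ≤ κ → ¬ R i j := fun j hj i hi h => by
    have hj' := (hEm j).1 hj
    exact c.not_adj_pred hw hw' (i := i) (j := j) (q := r) (by omega) (by omega) (by omega)
      (by omega) le_rfl h hj'.2
  have hκn := c.add_two_mul_le hw hw' (E := E) (card_pos.1 (by omega))
    (fun j hj => by have := (hEm j).1 hj; omega) hEhit
  -- the columns hit by low rows
  set C := (Icc κ (r - 1)).filter (fun j => ∃ i, i + 2 ≤ κ ∧ R i j) with hC
  have hCm : ∀ x, x ∈ C ↔ (κ ≤ x ∧ x ≤ r - 1) ∧ ∃ i, i + 2 ≤ κ ∧ R i x := fun x => by simp [hC]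
  have hCE : Disjoint C E := by
    rw [disjoint_left]
    intro x hx hxE
    obtain ⟨_, i, hi, h⟩ := (hCm x).1 hx
    exact hEhit x hxE i hi h
  have hCκ : ∀ x ∈ C, κ ∉ C → κ + 1 ≤ x := fun x hx h => by
    have := (hCm x).1 hx
    by_contra hc
    obtain rfl : x = κ := by omega
    exact h hx
  have hγ1 : C.card + E.card ≤ r - κ := by
    rw [← card_union_of_disjoint hCE]
    have : C ∪ E ⊆ Icc κ (r - 1) := fun x hx => by
      rw [mem_union, hCm, hEm] at hx
      rw [mem_Icc]; omega
    have := card_le_card this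
    rw [Nat.card_Icc] at this
    omega
  have hγ2 : κ ∉ C → C.card + E.card ≤ r - κ - 1 := by
    intro h
    rw [← card_union_of_disjoint hCE]
    have : C ∪ E ⊆ Icc (κ + 1) (r - 1) := fun x hx => by
      rw [mem_union] at hx
      rw [mem_Icc]
      rcases hx with hx | hx
      · have := hCκ x hx h
        have := (hCm x).1 hx
        omega
      · exact ((hEm x).1 hx).1
    have := card_le_card this
    rw [Nat.card_Icc] at this
    omega
  -- the out-neighbours of `0`
  set N := (Icc κ (r - 1)).filter (R 0) with hN
  have hNm : ∀ x, x ∈ N ↔ (κ ≤ x ∧ x ≤ r - 1) ∧ R 0 x := fun x => by simp [hN]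
  have hNC : N ⊆ C := fun x hx => by
    have := (hNm x).1 hx
    exact (hCm x).2 ⟨this.1, 0, by omega, this.2⟩
  -- The shift makes `D` the predecessors of out-neighbours of `0`; by `not_adj_pred` they have no
  -- out-neighbour beyond `κ`.
  set D := (Icc 1 (κ - 2)).filter (fun x => R 0 (x + 1)) with hD
  have hDm : ∀ x, x ∈ D ↔ (1 ≤ x ∧ x ≤ κ - 2) ∧ R 0 (x + 1) := fun x => by simp [hD]
  have hg : a ≤ N.card + D.card + 2 := by
    calc a ≤ _ := c.le_out 0 (by omega)
      _ ≤ (N ∪ D.image (· + 1) ∪ {1, r}).card := card_le_card fun x hx => by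
        simp only [mem_filter, mem_range] at hx
        have h1 := c.le_of_adj_zero hx.2
        have h0 : x ≠ 0 := by rintro rfl; exact c.not_adj_self _ hx.2
        by_cases hx1 : x = 1 ∨ x = r
        · exact mem_union_right _ (by simpa using hx1)
        · refine mem_union_left _ (mem_union.2 ?_)
          by_cases hxκ : κ ≤ x
          · exact Or.inl ((hNm x).2 ⟨by omega, hx.2⟩)
          · refine Or.inr (mem_image.2 ⟨x - 1, (hDm _).2 ⟨by omega, ?_⟩, by omega⟩)
            rw [show x - 1 + 1 = x by omega]
            exact hx.2
      _ ≤ N.card + D.card + 2 := (card_union_le _ _).trans (Nat.add_le_add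
          ((card_union_le _ _).trans (Nat.add_le_add_left card_image_le _)) card_le_two)
  have hDdead : ∀ x ∈ D, ∀ q, κ < q → ¬ R x q := fun x hx q hq h => by
    have hx' := (hDm x).1 hx
    have := hP x q (by omega) h
    exact c.not_adj_pred hw hw' (i := 0) (j := x + 1) (q := q) (by omega) (by omega) (by omega)
      (by omega) (by omega) hx'.2 h
  have hdead : κ ∈ C → ∀ q, κ < q → ¬ R (κ - 1) q := fun hκC q hq h => by
    obtain ⟨_, i, hi, hiκ⟩ := (hCm κ).1 hκC
    have := hP (κ - 1) q (by omega) h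
    exact c.not_adj_pred hw hw' (i := i) (j := κ) (q := q) (by omega) (by omega) (by omega)
      (by omega) (by omega) hiκ h
  have hDr : D ⊆ range κ := fun x hx => by
    have := (hDm x).1 hx
    rw [mem_range]; omega
  -- When `κ` is hit, `κ - 1` also has no out-neighbour beyond `κ`, so `D ∪ {κ - 1}` is confined to
  -- `[0, κ]`. The step into its least element makes the count strict.
  have hD1 : κ ∈ C → 2 * a + D.card < 2 * κ := by
    intro hκC
    have hmem : κ - 1 ∉ D := fun h => by have := (hDm _).1 h; omega
    have hsub : insert (κ - 1) D ⊆ range κ := fun x hx => by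
      rcases mem_insert.1 hx with rfl | hx
      · rw [mem_range]; omega
      · exact hDr hx
    have hne : (insert (κ - 1) D).Nonempty := insert_nonempty _ _
    have hmm := (insert (κ - 1) D).min'_mem hne
    have hml := (insert (κ - 1) D).min'_le
    set u := (insert (κ - 1) D).min' hne
    have hu1 : 1 ≤ u := by
      rcases mem_insert.1 hmm with h | h
      · omega
      · exact ((hDm _).1 h).1.1
    have hur := mem_range.1 (hsub hmm)
    have hut : u - 1 ∉ insert (κ - 1) D := fun h => by have := hml _ h; omega
    have := c.two_mul_add_one_lt (Z := insert (κ - 1) D)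
      (T := insert κ (range κ \ insert (κ - 1) D))
      (fun x hx => by have := mem_range.1 (hsub hx); omega) (by
        intro y hy x hyx
        by_cases hx : x ∈ insert (κ - 1) D
        · exact Or.inl hx
        · right
          rw [mem_insert, mem_sdiff, mem_range]
          by_cases hxκ : κ < x
          · rcases mem_insert.1 hy with rfl | hy
            · exact absurd hyx (hdead hκC x hxκ)
            · exact absurd hyx (hDdead y hy x hxκ)
          · rcases Nat.lt_or_ge x κ with h | h
            · exact Or.inr ⟨h, hx⟩
            · exact Or.inl (by omega))
      (t := u - 1) (u := u) (by
        rw [mem_insert, mem_sdiff, mem_range]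
        exact Or.inr ⟨by omega, hut⟩) hut hmm (by
        have := c.step (u - 1) (by omega)
        rwa [show u - 1 + 1 = u by omega] at this)
    have hcT := card_insert_le κ (range κ \ insert (κ - 1) D)
    have hcs := card_le_card hsub
    rw [card_sdiff_of_subset hsub, card_range] at hcT
    rw [card_range] at hcs
    rw [card_insert_of_notMem hmem] at this hcT hcs
    omega
  have hD2 : κ ∉ C → D.Nonempty → 2 * a + 1 + D.card < 2 * κ := by
    intro hκC hne
    have hmm := D.min'_mem hne
    have hml := D.min'_le
    set u := D.min' hne
    have hu := (hDm u).1 hmm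
    have hut : u - 1 ∉ D := fun h => by have := hml _ h; omega
    have := c.two_mul_add_one_lt (Z := D) (T := range κ \ D)
      (fun x hx => by have := mem_range.1 (hDr hx); omega) (by
        intro y hy x hyx
        by_cases hx : x ∈ D
        · exact Or.inl hx
        · right
          rw [mem_sdiff, mem_range]
          refine ⟨?_, hx⟩
          by_contra hxκ
          rcases Nat.lt_or_ge κ x with h | h
          · exact hDdead y hy x h hyx
          · obtain rfl : x = κ := by omega
            have := (hDm y).1 hy
            exact hκC ((hCm _).2 ⟨by omega, y, by omega, hyx⟩))
      (t := u - 1) (u := u) (by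
        rw [mem_sdiff, mem_range]
        exact ⟨by omega, hut⟩) hut hmm (by
        have := c.step (u - 1) (by omega)
        rwa [show u - 1 + 1 = u by omega] at this)
    have hcs := card_le_card hDr
    rw [card_sdiff_of_subset hDr, card_range] at this
    rw [card_range] at hcs
    omega
  have hDle : D.card + 3 ≤ a := by
    by_cases hκC : κ ∈ C
    · have := hD1 hκC; omega
    · by_cases hne : D.Nonempty
      · have := hD2 hκC hne; omega
      · rw [not_nonempty_iff_eq_empty] at hne
        rw [hne, card_empty]; omega
  have hNne : N.Nonempty := card_pos.1 (by omega)
  have hjN := N.min'_mem hNne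
  have hjmin := N.min'_le
  set j := N.min' hNne with hjdef
  have hj := (hNm j).1 hjN
  set C₁ := C.filter (· ≤ j) with hC₁
  set C₂ := C.filter (fun x => ¬ x ≤ j) with hC₂
  have hCcard : C₁.card + C₂.card = C.card := card_filter_add_card_filter_not _
  have hjC₁ : j ∈ C₁ := mem_filter.2 ⟨hNC hjN, le_rfl⟩
  have hv1 : 1 ≤ C₁.card := card_pos.2 ⟨j, hjC₁⟩
  have hvg : N.card + C₁.card ≤ C.card + 1 := by
    have hd : Disjoint N (C₁.erase j) := by
      rw [disjoint_left]
      intro x hx hx'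
      rw [mem_erase, hC₁, mem_filter] at hx'
      have := hjmin x hx
      omega
    have hs : N ∪ C₁.erase j ⊆ C :=
      union_subset hNC ((erase_subset _ _).trans (filter_subset _ _))
    have := card_le_card hs
    rw [card_union_of_disjoint hd, card_erase_of_mem hjC₁] at this
    omega
  have hrow : ∀ p q, 1 ≤ p → p + 2 ≤ κ → j < q → q ≤ r → R p q → p ≤ C₁.card := by
    intro p q hp1 hp2 hjq hq hpq
    refine c.le_card_hit hw hw' (C := C) (fun x h1 h2 i hi hix => (hCm x).2 ⟨by omega, i, hi, hix⟩)
      hj.1.1 hj.2 hp1 hp2 hjq hq hpq fun t htp htC htκ => ?_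
    have hκC : κ ∈ C := (hCm κ).2 ⟨by omega, t, by omega, htκ⟩
    have := hD1 hκC
    replace htC : t < C₁.card := htC
    exact c.exists_path_of_hit hw hw' hmin (i := t) (by omega) htκ htp hp2 (by omega)
  -- counting the arcs from the low rows
  set Q := Icc 1 (κ - 2) with hQ
  have hQc : Q.card = κ - 2 := by simp [hQ]
  have hQm : ∀ x, x ∈ Q ↔ 1 ≤ x ∧ x ≤ κ - 2 := fun x => by simp [hQ]
  have hDQ : D ⊆ Q := filter_subset _ _
  set M := arcs R Q (Icc κ (r - 1)) with hM
  -- If `κ` is hit, each row of `D` can still use that one column; otherwise these rows contribute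
  -- nothing to `M`.
  set b := if κ ∈ C then 1 else 0 with hb
  have hMup : M ≤ (κ - 2 - D.card) * C₁.card + C₁.card * (C.card - C₁.card) + D.card * b := by
    have e0 : M = arcs R D (Icc κ (r - 1)) + arcs R (Q \ D) (Icc κ (r - 1)) := by
      rw [← arcs_union_left disjoint_sdiff, union_sdiff_of_subset hDQ]
    have e1 : arcs R D (Icc κ (r - 1)) ≤ D.card * b := by
      unfold arcs
      rw [← smul_eq_mul, ← sum_const]
      refine sum_le_sum fun x hx => ?_
      have hx' := (hDm x).1 hx
      by_cases hκC : κ ∈ C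
      · rw [hb, if_pos hκC]
        refine (card_le_card (t := {κ}) fun y hy => ?_).trans (card_singleton κ).le
        rw [mem_filter, mem_Icc] at hy
        rw [mem_singleton]
        by_contra hne
        exact hDdead x hx y (by omega) hy.2
      · rw [hb, if_neg hκC, Nat.le_zero, card_eq_zero, filter_eq_empty_iff]
        intro y hy hxy
        rw [mem_Icc] at hy
        have hyC : y ∈ C := (hCm y).2 ⟨hy, x, by omega, hxy⟩
        exact hDdead x hx y (hCκ y hyC hκC) hxy
    have e2 : arcs R (Q \ D) (Icc κ (r - 1)) ≤ arcs R (Q \ D) (C₁ ∪ C₂) := by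
      unfold arcs
      refine sum_le_sum fun x hx => card_le_card fun y hy => ?_
      have hx' := (hQm x).1 (mem_sdiff.1 hx).1
      rw [mem_filter, mem_Icc] at hy
      rw [mem_filter, hC₁, hC₂, filter_union_filter_not_eq]
      exact ⟨(hCm y).2 ⟨hy.1, x, by omega, hy.2⟩, hy.2⟩
    have hC₁₂ : Disjoint C₁ C₂ := disjoint_filter_filter_not _ _ _
    rw [arcs_union_right hC₁₂] at e2
    have e3 : arcs R (Q \ D) C₁ ≤ (κ - 2 - D.card) * C₁.card := by
      refine arcs_le_mul.trans ?_
      rw [card_sdiff_of_subset hDQ, hQc]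
    have e4 : arcs R (Q \ D) C₂ ≤ C₁.card * (C.card - C₁.card) := by
      have : arcs R (Q \ D) C₂ ≤ arcs R (Icc 1 C₁.card) C₂ := by
        have h1 : arcs R (Q \ D) C₂ ≤ arcs R (Icc 1 C₁.card ∪ (Q \ Icc 1 C₁.card)) C₂ :=
          arcs_mono (fun x hx => by
            rw [union_sdiff_self_eq_union]
            exact mem_union_right _ (mem_sdiff.1 hx).1) Subset.rfl
        rw [arcs_union_left disjoint_sdiff, arcs_eq_zero (s := Q \ Icc 1 C₁.card)] at h1
        · exact h1
        · intro p hp q hq hpq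
          rw [mem_sdiff, hQm, mem_Icc] at hp
          rw [hC₂, mem_filter] at hq
          have hq' := (hCm q).1 hq.1
          have := hrow p q (by omega) (by omega) (by omega) (by omega) hpq
          omega
      refine (this.trans arcs_le_mul).trans ?_
      rw [Nat.card_Icc, Nat.add_sub_cancel, ← hCcard, Nat.add_sub_cancel_left]
    omega
  have hQb : ∀ x ∈ Q, x ≤ n + a := fun x hx => by rw [hQm] at hx; omega
  have f1 := c.mul_le_arcs hQb
  have f2 := c.two_arcs hQb
  have f3 : arcs R Q (range (n + a + 1)) ≤
      arcs R Q ({0} ∪ (Q ∪ ({κ - 1} ∪ Icc κ (r - 1)))) := by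
    unfold arcs
    refine sum_le_sum fun x hx => card_le_card fun y hy => ?_
    rw [hQm] at hx
    rw [mem_filter] at hy ⊢
    refine ⟨?_, hy.2⟩
    have := hP x y (by omega) hy.2
    have : y ≠ r := by rintro rfl; exact hcon x (by omega) (by omega) hy.2
    simp only [mem_union, mem_singleton, hQm, mem_Icc]
    omega
  rw [arcs_union_right (by simp only [disjoint_left, mem_union, mem_singleton, hQm, mem_Icc]; omega),
    arcs_union_right (by simp only [disjoint_left, mem_union, mem_singleton, hQm, mem_Icc]; omega),
    arcs_union_right (by simp only [disjoint_left, mem_singleton, mem_Icc]; omega)] at f3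
  -- `0` dominates `1` and the successors of `D`; `κ - 2` is erased because its successor lies
  -- outside `Q`.
  have f4 : arcs R Q {0} + 1 + (D.card - 1) ≤ κ - 2 := by
    rw [arcs_singleton_right, ← hQc]
    have hsub : insert 1 ((D.erase (κ - 2)).image (· + 1)) ⊆ Q := by
      intro x hx
      rw [mem_insert, mem_image] at hx
      rw [hQm]
      rcases hx with rfl | ⟨y, hy, rfl⟩
      · omega
      · rw [mem_erase, hDm] at hy
        omega
    have hd : Disjoint (Q.filter (R · 0)) (insert 1 ((D.erase (κ - 2)).image (· + 1))) := by
      rw [disjoint_left]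
      intro x hx hx'
      rw [mem_filter] at hx
      rw [mem_insert, mem_image] at hx'
      rcases hx' with rfl | ⟨y, hy, rfl⟩
      · exact c.asymm _ _ hx.2 (c.step 0 (by omega))
      · rw [mem_erase, hDm] at hy
        exact c.asymm _ _ hx.2 hy.2.2
    have := card_le_card (union_subset (filter_subset (R · 0) Q) hsub)
    rw [card_union_of_disjoint hd, card_insert_of_notMem, card_image_of_injective _
      (add_left_injective 1)] at this
    · have := pred_card_le_card_erase (s := D) (a := κ - 2)
      omega
    · rw [mem_image]
      rintro ⟨y, hy, h⟩
      rw [mem_erase, hDm] at hy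
      omega
  have f5 : arcs R Q {κ - 1} + (a - 2) * b ≤ κ - 2 := by
    have h1 := c.arcs_swap (s := {κ - 1}) (t := Q) (fun x hx => by rw [mem_singleton] at hx; omega)
      hQb (by simp only [disjoint_left, mem_singleton, hQm]; omega)
    rw [card_singleton, one_mul, hQc] at h1
    by_cases hκC : κ ∈ C
    · rw [hb, if_pos hκC]
      have : a ≤ arcs R {κ - 1} Q + 2 := by
        rw [arcs_singleton_left]
        calc a ≤ _ := c.le_out (κ - 1) (by omega)
          _ ≤ (Q.filter (R (κ - 1)) ∪ {0, κ}).card := card_le_card fun x hx => by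
            rw [mem_filter] at hx
            rw [mem_union, mem_filter, hQm, mem_insert, mem_singleton]
            have h1 : ¬ κ < x := fun h => hdead hκC x h hx.2
            have h2 : x ≠ κ - 1 := by rintro rfl; exact hself _ hx.2
            by_cases hx0 : x = 0 ∨ x = κ
            · exact Or.inr hx0
            · exact Or.inl ⟨by omega, hx.2⟩
          _ ≤ _ := (card_union_le _ _).trans (Nat.add_le_add_left card_le_two _)
      omega
    · rw [hb, if_neg hκC]
      omega
  rw [hQc] at f1 f2
  have hlow : a * (κ - 2) + 1 + (D.card - 1) + (a - 2) * b ≤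
      2 * (κ - 2) + arcs R Q Q + M := by omega
  have hDκ : D.card ≤ κ - 2 := hQc ▸ card_le_card hDQ
  clear f1 f3 f4 f5 hrow
  generalize arcs R Q Q = A at *
  have hvC : C₁.card ≤ C.card := by omega
  have z1 : ((κ - 2 : ℕ) : ℤ) = (κ : ℤ) - 2 := by omega
  have z2 : ((κ - 2 - D.card : ℕ) : ℤ) = (κ : ℤ) - 2 - D.card := by omega
  have z3 : ((C.card - C₁.card : ℕ) : ℤ) = (C.card : ℤ) - C₁.card := by omega
  have z4 : ((a - 2 : ℕ) : ℤ) = (a : ℤ) - 2 := by omega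
  zify at hMup hlow f2
  rw [z2, z3] at hMup
  rw [z1, z4] at hlow
  rw [z1] at f2
  by_cases hκC : κ ∈ C
  · rw [hb, if_pos hκC] at hMup hlow
    have := hD1 hκC
    refine count_arith_hit (a := a) (κ := κ) (d := D.card) (v := C₁.card) (γ := C.card) (M := M)
      (A := A) (n := n) (r := r) (g := N.card) (by omega) (by omega) (by omega) (by omega) (by omega)
      (by omega) (by omega) (by omega) (by omega) ?_ f2 ?_
    · simpa using hMup
    · have : ((D.card - 1 : ℕ) : ℤ) ≥ (D.card : ℤ) - 1 := by omega
      push_cast at hlow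
      linarith
  · rw [hb, if_neg hκC] at hMup hlow
    have hγ3 := hγ2 hκC
    by_cases hne : D.Nonempty
    · have := hD2 hκC hne
      have hd1 := card_pos.2 hne
      refine count_arith_not_hit (a := a) (κ := κ) (d := D.card) (v := C₁.card) (γ := C.card) (M := M)
        (A := A) (n := n) (r := r) (g := N.card) (by omega) (by omega) (by omega) (by omega)
        (by omega) (by omega) (by omega) (by omega) (by omega) ?_ f2 ?_
      · simpa using hMup
      · have : ((D.card - 1 : ℕ) : ℤ) = (D.card : ℤ) - 1 := by omega
        push_cast at hlow
        linarith
    · rw [not_nonempty_iff_eq_empty] at hne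
      have hd0 : D.card = 0 := by rw [hne, card_empty]
      rw [hd0] at hMup hlow hg
      refine count_arith_zero (a := a) (κ := κ) (v := C₁.card) (γ := C.card) (M := M)
        (A := A) (n := n) (r := r) (g := N.card) (by omega) (by omega) (by omega) (by omega)
        (by omega) (by omega) (by omega) (by omega) (by omega) ?_ f2 ?_
      · simpa using hMup
      · push_cast at hlow
        linarith

theorem elim (c : Config R n a r k) : False := by
  have hrN := c.r_lt
  have hne : (Ioc r (n + a)).Nonempty := ⟨r + 1, by rw [mem_Ioc]; omega⟩
  obtain ⟨w₀, hw₀, hmin⟩ := exists_min_image (Ioc r (n + a)) k hne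
  obtain ⟨w₁, hw₁, hmax⟩ := exists_max_image (Ioc r (n + a)) k hne
  rw [mem_Ioc] at hw₀ hw₁
  have hmin' : ∀ w, r < w → w ≤ n + a → k w₀ ≤ k w := fun w h1 h2 => hmin w (mem_Ioc.2 ⟨h1, h2⟩)
  have hmax' : ∀ w, r < w → w ≤ n + a → k w ≤ k w₁ := fun w h1 h2 => hmax w (mem_Ioc.2 ⟨h1, h2⟩)
  rcases c.not_adj_last_or_not_adj_zero hw₀.1 hw₀.2 hw₁.1 hw₁.2 hmin' hmax' with h | h
  · obtain ⟨p, h1, h2, h3⟩ := c.exists_adj_last hw₀.1 hw₀.2 hmin'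
    exact h p h1 h2 h3
  · have hk := c.k_add_two_le hw₁.1 hw₁.2
    obtain ⟨p, h1, h2, h3⟩ := c.reverse.exists_adj_last hw₁.1 hw₁.2
      (fun w h1 h2 => by have := hmax' w h1 h2; omega)
    rw [flip_of_le le_rfl, flip_of_le (by omega), Nat.sub_self] at h3
    exact h (r - p) (by omega) (by omega) h3

end Config

/-! ### From a tournament to a configuration -/

/-- If `i → w` but `w → i + 1`, inserting `w` between them lengthens the path, so domination of `w`
persists from its first occurrence on. -/
theorem exists_threshold {R : ℕ → ℕ → Prop} {r w : ℕ} (hw : r < w)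
    (step : ∀ i, i < r → R i (i + 1)) (total : ∀ i, i ≤ r → R i w ∨ R w i)
    (no_path : ∀ s, ¬ HamPath R s 0 r (r + 2)) :
    ∃ κ, κ ≤ r + 1 ∧ (∀ i, i ≤ r → i < κ → R w i) ∧ ∀ i, i ≤ r → κ ≤ i → R i w := by
  have hex : ∃ i, i = r + 1 ∨ R i w := ⟨r + 1, Or.inl rfl⟩
  refine ⟨Nat.find hex, Nat.find_min' hex (Or.inl rfl), fun i hi hiκ => ?_, fun i hi hκi => ?_⟩
  · have := Nat.find_min hex hiκ
    push Not at this
    exact (total i hi).resolve_left this.2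
  · induction i, hκi using Nat.le_induction with
    | base => exact (Nat.find_spec hex).resolve_left (by omega)
    | succ i hκi ih =>
      have hi' := ih (by omega)
      by_contra hcon
      have hwi := (total (i + 1) hi).resolve_left hcon
      have p1 := (HamPath.Icc_self_le (R := R) (Nat.zero_le i) fun x _ hx => step x (by omega)).cat
        (HamPath.single w) (by simp only [disjoint_left, mem_Icc, mem_singleton]; omega) hi'
      have p2 := p1.cat (HamPath.Icc_self_le (R := R) hi fun x _ hx => step x (by omega)) (by
        simp only [disjoint_left, mem_union, mem_Icc, mem_singleton]; omega) hwi
      exact no_path _ (p2.congr rfl (by omega))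

theorem exists_numbering {U : Type*} [Fintype U] {N r : ℕ} (hU : Fintype.card U = N) (hr : r < N)
    (p : Fin (r + 1) → U) (hp : Function.Injective p) :
    ∃ φ : ℕ → U, (∀ u, ∃ i < N, φ i = u) ∧ (∀ i j, i < N → j < N → φ i = φ j → i = j) ∧
      ∀ i : Fin (r + 1), φ i = p i := by
  have e₀ : Fin N ≃ U := (Fintype.equivFinOfCardEq hU).symm
  have hf : Function.Injective fun i : Fin (r + 1) => e₀ (Fin.castLE hr i) :=
    e₀.injective.comp (Fin.castLE_injective hr)
  let e := (Equiv.ofInjective _ hf).symm.trans (Equiv.ofInjective p hp)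
  have he : ∀ i : Fin (r + 1), e.extendSubtype (e₀ (Fin.castLE hr i)) = p i := by
    intro i
    rw [Equiv.extendSubtype_apply_of_mem _ _ ⟨i, rfl⟩]
    have : (⟨e₀ (Fin.castLE hr i), ⟨i, rfl⟩⟩ :
        Set.range fun i : Fin (r + 1) => e₀ (Fin.castLE hr i)) = Equiv.ofInjective _ hf i := rfl
    simp only [e, Equiv.trans_apply]
    erw [this, Equiv.symm_apply_apply]
    rfl
  refine ⟨fun i => if h : i < N then e.extendSubtype (e₀ ⟨i, h⟩) else p 0, fun u => ?_,
    fun i j hi hj h => ?_, fun i => ?_⟩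
  · obtain ⟨i, rfl⟩ := (e₀.trans e.extendSubtype).surjective u
    exact ⟨i, i.2, by simp⟩
  · simp only [dif_pos hi, dif_pos hj] at h
    simpa using (e₀.trans e.extendSubtype).injective h
  · have hi : (i : ℕ) < N := by omega
    simp only [dif_pos hi]
    exact he i

/-- In a tournament on `n + a + 1` vertices with `n + 2 ≤ 2 a` and all degrees at least `a`, an
`(x, y)`-path of length `r ≥ 3` that misses a vertex implies one of length `r + 1`. -/
theorem hasPathOfLength_succ {U : Type*} [Fintype U] {D : Digraph U} (hD : D.IsTournament)
    {n a r : ℕ} (ha : 4 ≤ a) (han : a ≤ n) (hn : n + 2 ≤ 2 * a) (hU : Fintype.card U = n + a + 1)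
    (hout : ∀ u, a ≤ (univ.filter (D.Adj u)).card)
    (hin : ∀ u, a ≤ (univ.filter (D.Adj · u)).card) (hr3 : 3 ≤ r) (hr : r < n + a) {x y : U}
    (h : D.HasPathOfLength x y r) : D.HasPathOfLength x y (r + 1) := by
  obtain ⟨p, hp, hpx, hpy, hstep⟩ := h
  obtain ⟨φ, hsurj, hinj, hφ⟩ := exists_numbering hU (by omega) p hp
  -- The explicit bounds are needed because `φ` takes an arbitrary value beyond the range of labels.
  let R : ℕ → ℕ → Prop := fun u v => u < n + a + 1 ∧ v < n + a + 1 ∧ D.Adj (φ u) (φ v)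
  have hφ0 : φ 0 = x := by rw [← hpx]; exact hφ 0
  have hφr : φ r = y := by rw [← hpy]; exact hφ (Fin.last r)
  by_contra hcon
  have hno : ∀ s, ¬ HamPath R s 0 r (r + 2) := by
    intro s hs
    obtain ⟨L, h1, h2, h3, -, h5, h6⟩ := hs.exists_list
    refine hcon ⟨fun i => φ (L.get (i.cast h1.symm)), ?_, ?_, ?_, ?_⟩
    · have hlt : ∀ i (hi : i < L.length), L[i] < n + a + 1 := by
        intro i hi
        rw [List.isChain_iff_getElem] at h3
        rcases Nat.eq_zero_or_pos i with rfl | hi0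
        · exact (h3 0 (by omega)).1
        · have := (h3 (i - 1) (by omega)).2.1
          simpa only [Nat.sub_add_cancel hi0] using this
      intro i j hij
      have := hinj _ _ (hlt _ _) (hlt _ _) hij
      have := List.nodup_iff_injective_get.1 h2 this
      simpa [Fin.ext_iff] using this
    · rw [← hφ0]
      rw [List.head?_eq_getElem?, List.getElem?_eq_some_iff] at h5
      exact congrArg φ h5.2
    · rw [← hφr]
      rw [List.getLast?_eq_getElem?, h1, List.getElem?_eq_some_iff] at h6
      exact congrArg φ h6.2
    · intro i
      rw [List.isChain_iff_getElem] at h3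
      exact (h3 i (by omega)).2.2
  have htot : ∀ u v, u ≤ n + a → v ≤ n + a → u ≠ v → R u v ∨ R v u := by
    intro u v hu hv huv
    rcases hD.adjacent (φ u) (φ v) (fun h => huv (hinj _ _ (by omega) (by omega) h)) with h | h
    · exact Or.inl ⟨by omega, by omega, h⟩
    · exact Or.inr ⟨by omega, by omega, h⟩
  have hstepR : ∀ i, i < r → R i (i + 1) := by
    intro i hi
    refine ⟨by omega, by omega, ?_⟩
    have h1 := hφ (⟨i, hi⟩ : Fin r).castSucc
    have h2 := hφ (⟨i, hi⟩ : Fin r).succ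
    simp only [Fin.val_castSucc, Fin.val_succ] at h1 h2
    rw [h1, h2]
    exact hstep ⟨i, hi⟩
  have hthr : ∀ w, ∃ κ, κ ≤ r + 1 ∧ (r < w → w ≤ n + a →
      (∀ i, i ≤ r → i < κ → R w i) ∧ ∀ i, i ≤ r → κ ≤ i → R i w) := by
    intro w
    by_cases hw : r < w ∧ w ≤ n + a
    · obtain ⟨κ, h1, h2⟩ := exists_threshold hw.1 hstepR
        (fun i hi => htot i w (by omega) hw.2 (by omega)) hno
      exact ⟨κ, h1, fun _ _ => h2⟩
    · exact ⟨0, by omega, fun h1 h2 => absurd ⟨h1, h2⟩ hw⟩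
  choose k hk hk' using hthr
  have hdeg : ∀ (P : U → Prop) (Q : ℕ → Prop), (∀ i < n + a + 1, P (φ i) → Q i) →
      (univ.filter P).card ≤ ((range (n + a + 1)).filter Q).card := by
    intro P Q hPQ
    refine (card_le_card fun u hu => ?_).trans (card_image_le (f := φ))
    obtain ⟨i, hi, rfl⟩ := hsurj u
    rw [mem_filter] at hu
    exact mem_image.2 ⟨i, mem_filter.2 ⟨mem_range.2 hi, hPQ i hi hu.2⟩, rfl⟩
  have c : Config R n a r k :=
    { four_le := ha
      a_le := han
      le_two_mul := hn
      three_le := hr3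
      r_lt := hr
      lt_of_adj := fun u v h => ⟨Nat.lt_succ_iff.1 h.1, Nat.lt_succ_iff.1 h.2.1⟩
      asymm := fun u v h h' => hD.asymm _ _ h.2.2 h'.2.2
      total := htot
      step := hstepR
      le_out := fun u hu => (hout (φ u)).trans (hdeg _ _ fun i hi h => ⟨by omega, hi, h⟩)
      le_in := fun u hu => (hin (φ u)).trans (hdeg _ _ fun i hi h => ⟨hi, by omega, h⟩)
      no_path := hno
      k_le := hk
      adj_of_lt := fun w h1 h2 => (hk' w h1 h2).1
      adj_of_le := fun w h1 h2 => (hk' w h1 h2).2 }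
  exact c.elim

theorem card_filter_adj {V : Type*} [Fintype V] {T : Digraph V} (hT : T.IsRegularTournament) {n : ℕ}
    (hV : Fintype.card V = 2 * n + 1) (v : V) :
    (univ.filter (T.Adj v)).card = n ∧ (univ.filter (T.Adj · v)).card = n := by
  have h1 : (univ.filter (T.Adj v)).card = (univ.filter (T.Adj · v)).card := by
    have := hT.outDegree_eq_inDegree v
    unfold Digraph.outDegree Digraph.inDegree at this
    rw [Set.ncard_eq_toFinset_card', Set.ncard_eq_toFinset_card'] at this
    simpa [Set.toFinset_ofPred] using this
  have h2 : univ.filter (T.Adj v) ∪ univ.filter (T.Adj · v) = univ.erase v := by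
    ext u
    simp only [mem_union, mem_filter, mem_univ, true_and, mem_erase, and_true]
    constructor
    · rintro (h | h) rfl <;> exact hT.loopless _ h
    · exact fun h => hT.adjacent v u (Ne.symm h)
  have h3 : Disjoint (univ.filter (T.Adj v)) (univ.filter (T.Adj · v)) := by
    rw [disjoint_left]
    intro u hu hu'
    exact hT.asymm _ _ (mem_filter.1 hu).2 (mem_filter.1 hu').2
  have h4 := card_union_of_disjoint h3
  rw [h2, card_erase_of_mem (mem_univ v), card_univ, hV] at h4
  omega

theorem le_card_filter_subtype {V : Type*} [Fintype V] (S : Finset V) (P : V → Prop) :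
    (univ.filter P).card ≤ S.card +
      (univ.filter fun u : {v : V // v ∉ (S : Set V)} => P u).card := by
  calc _ ≤ (S ∪ (univ.filter fun u : {v : V // v ∉ (S : Set V)} => P u).image Subtype.val).card :=
        card_le_card fun u hu => by
          rw [mem_filter] at hu
          by_cases hS : u ∈ S
          · exact mem_union_left _ hS
          · exact mem_union_right _ (mem_image.2 ⟨⟨u, hS⟩, by simpa using hu.2, rfl⟩)
    _ ≤ _ := (card_union_le _ _).trans (Nat.add_le_add_left card_image_le _)

end PathExtension

theorem theorem1p4 {V : Type*} [Fintype V] (T : Digraph V) (hT : T.IsRegularTournament)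
    (n : ℕ) (hV : Fintype.card V = 2 * n + 1) (hn : 11 ≤ 2 * n + 1)
    (S : Finset V) (hS : (S.card : ℝ) ≤ ((n : ℝ) - 2) / 2)
    (x y : {v : V // v ∉ (S : Set V)}) (hxy : x ≠ y)
    (r : ℕ) (hr : (r : ℤ) ∈ Set.Icc (3 : ℤ) (2 * (n : ℤ) - (S.card : ℤ) - 1))
    (hP : (T.deleteVerts (S : Set V)).HasPathOfLength x y r) :
    (T.deleteVerts (S : Set V)).HasPathOfLength x y (r + 1) := by
  classical
  have hS' : 2 * S.card + 2 ≤ n := by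
    have : (2 * S.card + 2 : ℝ) ≤ n := by linarith
    exact_mod_cast this
  rw [Set.mem_Icc] at hr
  have hdel : (T.deleteVerts (S : Set V)).IsTournament :=
    { loopless := fun v => hT.loopless v
      asymm := fun u v => hT.asymm u v
      adjacent := fun u v huv => hT.adjacent u v fun h => huv (Subtype.ext h) }
  -- With `a = n - |S|`, the bound on `|S|` is `n + 2 ≤ 2 * a`, and `n ≥ 5` then gives `a ≥ 4`.
  -- Deleting `S` lowers each degree from `n` to no less than `a`.
  refine PathExtension.hasPathOfLength_succ hdel (n := n) (a := n - S.card) (by omega) (by omega)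
    (by omega) ?_ (fun u => ?_) (fun u => ?_) (by omega) (by omega) hP
  · have : Fintype.card {v : V // v ∉ (S : Set V)} = Fintype.card V - S.card := by
      simp
    omega
  · have h1 := (PathExtension.card_filter_adj hT hV u).1
    have h2 := PathExtension.le_card_filter_subtype S (T.Adj u)
    have : n - S.card ≤ (Finset.univ.filter fun v : {v : V // v ∉ (S : Set V)} => T.Adj u v).card := by
      omega
    exact this
  · have h1 := (PathExtension.card_filter_adj hT hV u).2
    have h2 := PathExtension.le_card_filter_subtype S (T.Adj · u)
    have : n - S.card ≤ (Finset.univ.filter fun v : {v : V // v ∉ (S : Set V)} => T.Adj v u).card := by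
      omega
    exact this
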